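/- Let $b_j\ge 0$ $(j\neq 1)$ with $0<-b_1=\sum_{j\ne 1}b_j<\infty$, and let $w_i>0$ $(i\ge 1)$. Let $\{X(t);t\ge 0\}$ be a regular (non-explosive) weighted Markov branching process with $X(0)=1$: a continuous-time Markov chain on $\mathbb{Z}_+=\{0,1,2,\dots\}$ whose paths are almost surely right-continuous step functions with finitely many jumps in bounded time intervals, and whose honest transition function $P(t)=(p_{ij}(t))$ has the $Q$-matrix $q_{ij}=w_ib_{j-i+1}$ if $i\ge 1$, $j\ge i-1$, and $q_{ij}=0$ otherwise, and satisfies $p_{ij}'(t)=\sum_{k}p_{ik}(t)q_{kj}$ for $i\ge 0$, $j\ge 1$, $t\ge 0$. Let $\tau=\inf\{t\ge 0: X(t)=0\}$ be the extinction time. Fix $m>1$ with $b_m>0$, and assume $b_0>0$. Let $Y_m(\tau)$ be the $(m-1)$-range up-crossing number until extinction, that is, the number of times $s\in(0,\tau]$ with $X(s)-X(s-)=m-1$. Let $\rho$ be the minimal nonnegative root of $B(u)=\sum_{j\ge 0}b_ju^j=0$, and let $\rho_0$ be the minimal nonnegative root of $B_m(u)=\sum_{j\ne m}b_ju^j=0$.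 Then both roots exist, $\rho>0$, $B_m'(\rho_0)<0$, and the recursion $$\rho_1=-\frac{b_m\rho_0^m}{B_m'(\rho_0)},\qquad \rho_{k+1}=-\frac{\sum_{i\neq 1,m}b_i\sum_{j_1+\cdots+j_i=k+1;\ j_1,\dots,j_i\le k}\rho_{j_1}\cdots\rho_{j_i}+b_m\rho_k^{*(m)}}{B_m'(\rho_0)}\quad(k\ge 1),$$ where $\rho_k^{*(m)}=\sum_{k_1+\cdots+k_m=k}\rho_{k_1}\cdots\rho_{k_m}$, is well defined (the series over $i$ converge). Moreover $P(\tau<\infty)>0$; the probability generating function of $Y_m(\tau)$ conditioned on $\tau<\infty$ is $$G(v)=E\big[v^{Y_m(\tau)}\,\big|\,\tau<\infty\big]=\rho^{-1}\sum_{k=0}^{\infty}\rho_kv^k,\qquad v\in[0,1],$$ and hence $$P\big(Y_m(\tau)=k\,\big|\,\tau<\infty\big)=\rho^{-1}\rho_k,\qquad k\ge 0 .$$ -/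

import Mathlib

open Set Filter Topology MeasureTheory ProbabilityTheory
open scoped NNReal ENNReal

namespace WMBP

/-- The branching rates: `b j ≥ 0` for `j ≠ 1` and `0 < -b 1 = ∑_{j ≠ 1} b j < ∞`. -/
structure IsBranchingRate (b : ℕ → ℝ) : Prop where
  nonneg : ∀ j, j ≠ 1 → 0 ≤ b j
  neg_one_pos : 0 < -b 1
  hasSum : HasSum (fun j => if j = 1 then 0 else b j) (-b 1)

/-- The weighted branching `Q`-matrix: `q i j = w i * b (j - i + 1)` if `i ≥ 1` and `j ≥ i - 1`,
and `0` otherwise. -/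
noncomputable def qMatrix (w b : ℕ → ℝ) (i j : ℕ) : ℝ :=
  if 1 ≤ i ∧ i ≤ j + 1 then w i * b (j + 1 - i) else 0

/-- An honest transition function on the state space `ℕ`. -/
structure IsTransitionFunction (p : ℝ≥0 → ℕ → ℕ → ℝ) : Prop where
  nonneg : ∀ t i j, 0 ≤ p t i j
  hasSum_one : ∀ t i, HasSum (fun j => p t i j) 1
  zero : ∀ i j, p 0 i j = if i = j then 1 else 0
  chapman_kolmogorov : ∀ s t i j, HasSum (fun k => p s i k * p t k j) (p (s + t) i j)

/-- `p` is a transition function with `Q`-matrix `q = qMatrix w b` (that is, `p'(0) = q`) which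
satisfies the forward equations `p' i j (t) = ∑ k, p i k (t) * q k j` for `i ≥ 0`, `j ≥ 1`, `t ≥ 0`
(one-sided derivatives at `t = 0`; the sums have finitely many nonzero terms, those with
`k ≤ j + 1`). -/
structure IsWMBTransitionFunction (w b : ℕ → ℝ) (p : ℝ≥0 → ℕ → ℕ → ℝ) : Prop
    extends IsTransitionFunction p where
  deriv_zero : ∀ i j,
    HasDerivWithinAt (fun s : ℝ => p s.toNNReal i j) (qMatrix w b i j) (Ici 0) 0
  forward : ∀ i j, 1 ≤ j → ∀ t : ℝ≥0,
    HasDerivWithinAt (fun s : ℝ => p s.toNNReal i j) (∑' k, p t i k * qMatrix w b k j)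
      (Ici 0) (t : ℝ)

/-- A regular (non-explosive) path in the discrete space `ℕ`: right-continuous, with a left limit
in `ℕ` at every positive time. Such a path is a step function with finitely many jumps in every
bounded time interval. -/
structure IsRegularPath (x : ℝ≥0 → ℕ) : Prop where
  right_continuous : ∀ t, ContinuousWithinAt x (Ici t) t
  left_limit : ∀ t, 0 < t → ∃ a : ℕ, Tendsto x (𝓝[<] t) (𝓝 a)

/-- `X` is a regular weighted Markov branching process with rates `b` and weights `w`: a
continuous-time Markov chain on `ℕ` with almost surely regular paths, whose transition function is a
weighted branching transition function. The Markov property is written without division: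
`P(X(t₀) = i₀, …, X(tₙ₊₁) = iₙ₊₁) = P(X(t₀) = i₀, …, X(tₙ) = iₙ) * p(tₙ₊₁ - tₙ; iₙ, iₙ₊₁)`. -/
structure IsWMBProcess {Ω : Type*} [MeasurableSpace Ω] (μ : Measure Ω) (w b : ℕ → ℝ)
    (X : ℝ≥0 → Ω → ℕ) : Prop where
  measurable : ∀ t, Measurable (X t)
  regular : ∀ᵐ ω ∂μ, IsRegularPath (fun t => X t ω)
  markov : ∃ p : ℝ≥0 → ℕ → ℕ → ℝ, IsWMBTransitionFunction w b p ∧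
    ∀ (t : ℕ → ℝ≥0), Monotone t → ∀ (i : ℕ → ℕ) (n : ℕ),
      μ.real {ω | ∀ l ≤ n + 1, X (t l) ω = i l} =
        μ.real {ω | ∀ l ≤ n, X (t l) ω = i l} * p (t (n + 1) - t n) (i n) (i (n + 1))

/-- The extinction time `τ = inf {t ≥ 0 : X(t) = 0}`, equal to `∞` if there is no such `t`. -/
noncomputable def extinctionTime (x : ℝ≥0 → ℕ) : ℝ≥0∞ :=
  ⨅ (t : ℝ≥0) (_ : x t = 0), (t : ℝ≥0∞)

/-- The `(m - 1)`-range crossing number up to time `T`: the number of times `s ∈ (0, T]` at which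
the path jumps by exactly `m - 1`, that is `x(s) - x(s-) = m - 1`. -/
noncomputable def crossingNumber (m : ℕ) (x : ℝ≥0 → ℕ) (T : ℝ≥0∞) : ℕ∞ :=
  Set.encard {s : ℝ≥0 | 0 < s ∧ (s : ℝ≥0∞) ≤ T ∧ ∀ᶠ r in 𝓝[<] s, x s + 1 = x r + m}

/-- `B(u) = ∑ⱼ bⱼ uʲ`. -/
noncomputable def B (b : ℕ → ℝ) (u : ℝ) : ℝ := ∑' j, b j * u ^ j

/-- `B_m(u) = ∑_{j ≠ m} bⱼ uʲ`. -/
noncomputable def Bm (b : ℕ → ℝ) (m : ℕ) (u : ℝ) : ℝ := ∑' j, if j = m then 0 else b j * u ^ j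

/-- The convolution power `r^{*(j)}_l = ∑_{l₁ + ⋯ + lⱼ = l} r_{l₁} ⋯ r_{lⱼ}`. -/
def convPow (r : ℕ → ℝ) (j l : ℕ) : ℝ :=
  ∑ x ∈ Finset.Nat.antidiagonalTuple j l, ∏ a, r (x a)

/-- The part of `r^{*(j)}_{k+1}` in which all indices are at most `k`:
`∑_{l₁ + ⋯ + lⱼ = k + 1; l₁, …, lⱼ ≤ k} r_{l₁} ⋯ r_{lⱼ}`. -/
def restrictedConvPow (r : ℕ → ℝ) (j k : ℕ) : ℝ :=
  ∑ x ∈ (Finset.Nat.antidiagonalTuple j (k + 1)).filter (fun x => ∀ a, x a ≤ k), ∏ a, r (x a)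

/-- The summands `bᵢ ∑_{j₁ + ⋯ + jᵢ = k + 1; j₁, …, jᵢ ≤ k} r_{j₁} ⋯ r_{jᵢ}`, `i ≠ 1, m`, of the
recursion. -/
noncomputable def recTerm (b : ℕ → ℝ) (m : ℕ) (r : ℕ → ℝ) (k i : ℕ) : ℝ :=
  if i = 1 ∨ i = m then 0 else b i * restrictedConvPow r i k

end WMBP

/-! For v in [0,1] consider the equation B_m(u) + b_m v u^m = 0, which is B_m(u) = 0 at v = 0 and
B(u) = 0 at v = 1. The proof solves it by a power series in v and shows that the solution is E[v^Y;
τ < ∞].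

Analytic half (`solution_induction`, `exists_solution`). Put R(v) = ∑ r_k v^k with r_0 = ρ_0 into
the equation. In the coefficient of v^(k+1) the unknown r_(k+1) occurs linearly, with factor
B_m'(ρ_0), and the rest is the stated recursion. As B_m is convex up to a linear term and negative
at 1, B_m'(ρ_0) < 0, so all r_k are nonnegative. Convexity also keeps the partial sums below ρ.
Hence the series converges at v = 1 to a root of B not exceeding ρ, and minimality of ρ gives ∑ r_k
= ρ. For v < 1 the value R(v) lies in (0,1).

Probabilistic half (`IsMarkov.integral_crossingCount`, `IsMarkov.integral_countPow`). If u solves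
the equation, the generator annihilates the function marking each jump of size m - 1 by v and the
state by u: row i gives w_i u^(i-1) (B_m(u) + b_m v u^m) = 0, whatever the weights. So v^(crossings
up to t) u^(X(t)) has constant mean u. This is proved on grids of vanishing mesh, where regular
paths have their crossings counted exactly. The states j ≥ 1 are transient and u < 1, so letting t →
∞ leaves E[v^Y; τ < ∞] = u.

Taking u = R(v) for 0 < v < 1 and comparing coefficients gives P(Y = k, τ < ∞) = r_k
(`IsMarkov.law_extinctionCount`). Summing gives P(τ < ∞) = ρ > 0, and conditioning is division by ρ.
-/

namespace WMBP

/-! ### Convolution powers of sequences -/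

section ConvPow

lemma convPow_zero (r : ℕ → ℝ) (l : ℕ) : convPow r 0 l = if l = 0 then 1 else 0 := by
  cases l <;> simp [convPow]

lemma convPow_succ (r : ℕ → ℝ) (j l : ℕ) :
    convPow r (j + 1) l = ∑ p ∈ Finset.HasAntidiagonal.antidiagonal l, r p.1 * convPow r j p.2 := by
  simp only [convPow, Finset.mul_sum]
  rw [Finset.sum_sigma']
  -- A tuple corresponds to its first entry together with its tail.
  refine Finset.sum_bij' (fun x _ => ⟨(x 0, ∑ a, Fin.tail x a), Fin.tail x⟩)
    (fun y _ => Fin.cons y.1.1 y.2) ?_ ?_ ?_ ?_ ?_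
  · intro x hx
    rw [Finset.Nat.mem_antidiagonalTuple, Fin.sum_univ_succ] at hx
    simp [Finset.Nat.mem_antidiagonalTuple, Fin.tail, hx]
  · rintro ⟨⟨a, c⟩, y⟩ hy
    simp only [Finset.mem_sigma, Finset.HasAntidiagonal.mem_antidiagonal, Finset.Nat.mem_antidiagonalTuple] at hy
    simp [Finset.Nat.mem_antidiagonalTuple, Fin.sum_univ_succ, hy]
  · intro x _
    simp
  · rintro ⟨⟨a, c⟩, y⟩ hy
    simp only [Finset.mem_sigma, Finset.HasAntidiagonal.mem_antidiagonal, Finset.Nat.mem_antidiagonalTuple] at hy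
    obtain ⟨_, rfl⟩ := hy
    simp
  · intro x _
    simp [Fin.prod_univ_succ, Fin.tail]

lemma convPow_zero_right (r : ℕ → ℝ) (j : ℕ) : convPow r j 0 = r 0 ^ j := by
  rw [convPow, Finset.Nat.antidiagonalTuple_zero_right]
  simp

lemma convPow_congr {r s : ℕ → ℝ} {l : ℕ} (h : ∀ a ≤ l, r a = s a) (j : ℕ) :
    convPow r j l = convPow s j l := by
  refine Finset.sum_congr rfl fun x hx => Finset.prod_congr rfl fun a _ => h _ ?_
  rw [Finset.Nat.mem_antidiagonalTuple] at hx
  rw [← hx]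
  exact Finset.single_le_sum (f := x) (fun _ _ => Nat.zero_le _) (Finset.mem_univ a)

lemma convPow_nonneg {r : ℕ → ℝ} (h : ∀ a, 0 ≤ r a) (j l : ℕ) : 0 ≤ convPow r j l :=
  Finset.sum_nonneg fun _ _ => Finset.prod_nonneg fun _ _ => h _

/-- The sequence `r` cut off after the index `k`. -/
def cutoff (r : ℕ → ℝ) (k l : ℕ) : ℝ := if l ≤ k then r l else 0

lemma restrictedConvPow_eq (r : ℕ → ℝ) (j k : ℕ) :
    restrictedConvPow r j k = convPow (cutoff r k) j (k + 1) := by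
  rw [restrictedConvPow, convPow, Finset.sum_filter]
  refine Finset.sum_congr rfl fun x _ => ?_
  split_ifs with h
  · exact Finset.prod_congr rfl fun a _ => by simp [cutoff, h a]
  · push Not at h
    obtain ⟨a, ha⟩ := h
    exact (Finset.prod_eq_zero (Finset.mem_univ a) (by simp [cutoff, ha])).symm

/-- If the indices add up to k + 1 and one of them exceeds k, that index is k + 1 and all others are
0; it can sit in any of j places. This isolates the linear occurrence of r (k + 1) on which the
recursion rests. At j = 0 the factor j makes the truncated exponent harmless. -/
lemma convPow_succ_eq (r : ℕ → ℝ) (k : ℕ) (j : ℕ) :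
    convPow r j (k + 1) = j * r 0 ^ (j - 1) * r (k + 1) + restrictedConvPow r j k := by
  rw [restrictedConvPow_eq]
  induction j with
  | zero => simp [convPow_zero]
  | succ j ih =>
    rw [convPow_succ, convPow_succ, Finset.Nat.sum_antidiagonal_succ',
      Finset.Nat.sum_antidiagonal_succ']
    simp only [convPow_zero_right]
    have h0 : cutoff r k 0 = r 0 := by simp [cutoff]
    have h1 : cutoff r k (k + 1) = 0 := by simp [cutoff]
    rw [h0, h1]
    have key : ∑ p ∈ Finset.HasAntidiagonal.antidiagonal k, r p.1 * convPow r j (p.2 + 1) =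
        ∑ p ∈ Finset.HasAntidiagonal.antidiagonal k, cutoff r k p.1 * convPow (cutoff r k) j (p.2 + 1) +
          r 0 * (j * r 0 ^ (j - 1) * r (k + 1)) := by
      -- Only the pair (0, k) leads back to index k + 1 in the j-th power, so the induction
      -- hypothesis is needed there alone; for all other pairs every index is at most k and the
      -- cutoff is invisible.
      rw [← Finset.add_sum_erase _ _ (show (0, k) ∈ Finset.HasAntidiagonal.antidiagonal k by simp),
        ← Finset.add_sum_erase (Finset.HasAntidiagonal.antidiagonal k)
          (fun p => cutoff r k p.1 * convPow (cutoff r k) j (p.2 + 1))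
          (show (0, k) ∈ Finset.HasAntidiagonal.antidiagonal k by simp)]
      simp only [ih, h0]
      have : ∑ p ∈ (Finset.HasAntidiagonal.antidiagonal k).erase (0, k), r p.1 * convPow r j (p.2 + 1) =
          ∑ p ∈ (Finset.HasAntidiagonal.antidiagonal k).erase (0, k),
            cutoff r k p.1 * convPow (cutoff r k) j (p.2 + 1) := by
        refine Finset.sum_congr rfl fun p hp => ?_
        obtain ⟨hp1, hp2⟩ := Finset.mem_erase.1 hp
        rw [Finset.HasAntidiagonal.mem_antidiagonal] at hp2
        have hpk : p.1 ≠ 0 := fun h => hp1 (Prod.ext h (by simp; omega))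
        have : cutoff r k p.1 = r p.1 := by simp [cutoff]; omega
        rw [this]
        congr 1
        exact convPow_congr (fun a ha => by simp [cutoff]; omega) j
      rw [this]
      ring
    rw [key]
    rcases j with _ | j
    · simp
    · simp only [Nat.add_sub_cancel]
      push_cast
      ring

lemma hasSum_convPow {r : ℕ → ℝ} {v R : ℝ} (h : HasSum (fun l => r l * v ^ l) R) (j : ℕ) :
    HasSum (fun l => convPow r j l * v ^ l) (R ^ j) := by
  induction j with
  | zero =>
    rw [pow_zero]
    convert hasSum_ite_eq (0 : ℕ) (1 : ℝ) using 2 with l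
    rw [convPow_zero]
    split_ifs with hl <;> simp [hl]
  | succ j ih =>
    have hn : Summable fun l => ‖r l * v ^ l‖ := h.summable.norm
    have hn' : Summable fun l => ‖convPow r j l * v ^ l‖ := ih.summable.norm
    have e : (fun l => convPow r (j + 1) l * v ^ l) = fun l =>
        ∑ p ∈ Finset.HasAntidiagonal.antidiagonal l, r p.1 * v ^ p.1 * (convPow r j p.2 * v ^ p.2) := by
      ext l
      rw [convPow_succ, Finset.sum_mul]
      refine Finset.sum_congr rfl fun p hp => ?_
      rw [← Finset.HasAntidiagonal.mem_antidiagonal.1 hp, pow_add]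
      ring
    rw [e, pow_succ', ← ih.tsum_eq, ← h.tsum_eq,
      tsum_mul_tsum_eq_tsum_sum_antidiagonal_of_summable_norm hn hn']
    exact (summable_norm_sum_mul_antidiagonal_of_summable_norm hn hn').of_norm.hasSum

end ConvPow

/-! ### The functions B and B_m on the unit interval -/

section Analytic

/-- `x ^ i - y ^ i ≥ i z ^ (i - 1) (x - y)` for `0 ≤ z ≤ y ≤ x`. -/
lemma mul_pow_mul_sub_le_pow_sub_pow {x y z : ℝ} (hz : 0 ≤ z) (hzy : z ≤ y) (hyx : y ≤ x) (i : ℕ) :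
    i * z ^ (i - 1) * (x - y) ≤ x ^ i - y ^ i := by
  induction i with
  | zero => simp
  | succ i ih =>
    -- The induction uses x^(i+1) - y^(i+1) = x (x^i - y^i) + y^i (x - y), bounding the two summands
    -- separately.
    have h1 : z * (i * z ^ (i - 1) * (x - y)) ≤ x * (x ^ i - y ^ i) :=
      mul_le_mul (hzy.trans hyx) ih
        (mul_nonneg (mul_nonneg (Nat.cast_nonneg _) (pow_nonneg hz _)) (sub_nonneg.2 hyx))
        (hz.trans (hzy.trans hyx))
    have h2 : z ^ i * (x - y) ≤ y ^ i * (x - y) :=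
      mul_le_mul_of_nonneg_right (pow_le_pow_left₀ hz hzy i) (sub_nonneg.2 hyx)
    have h3 : z * (i * z ^ (i - 1) * (x - y)) = i * z ^ i * (x - y) := by
      rcases i with _ | i
      · simp
      · simp only [Nat.add_sub_cancel]; ring
    rw [h3] at h1
    simp only [Nat.add_sub_cancel]
    push_cast
    calc ((i : ℝ) + 1) * z ^ i * (x - y) = i * z ^ i * (x - y) + z ^ i * (x - y) := by ring
      _ ≤ x * (x ^ i - y ^ i) + y ^ i * (x - y) := add_le_add h1 h2
      _ = _ := by ring

variable {b : ℕ → ℝ}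

lemma IsBranchingRate.hasSum_zero (hb : IsBranchingRate b) : HasSum b 0 := by
  have h := hb.hasSum.add (hasSum_ite_eq 1 (b 1))
  rw [neg_add_cancel] at h
  convert h using 2 with j
  split_ifs with hj <;> simp [hj]

lemma IsBranchingRate.hasSum_B (hb : IsBranchingRate b) {u : ℝ} (hu : u ∈ Icc (0 : ℝ) 1) :
    HasSum (fun j => b j * u ^ j) (B b u) := by
  refine Summable.hasSum ?_
  refine Summable.of_norm_bounded hb.hasSum_zero.summable.norm fun j => ?_
  rw [norm_mul]
  refine mul_le_of_le_one_right (norm_nonneg _) ?_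
  rw [norm_pow, Real.norm_of_nonneg hu.1]
  exact pow_le_one₀ hu.1 hu.2

/-- The rates with the `m`-th one removed. -/
noncomputable def rateWithout (b : ℕ → ℝ) (m j : ℕ) : ℝ := if j = m then 0 else b j

lemma norm_rateWithout_le (b : ℕ → ℝ) (m j : ℕ) : ‖rateWithout b m j‖ ≤ ‖b j‖ := by
  unfold rateWithout
  split_ifs <;> simp

lemma IsBranchingRate.rateWithout_nonneg (hb : IsBranchingRate b) (m : ℕ) {j : ℕ} (hj : j ≠ 1) :
    0 ≤ rateWithout b m j := by
  unfold rateWithout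
  split_ifs
  exacts [le_rfl, hb.nonneg j hj]

lemma Bm_eq (b : ℕ → ℝ) (m : ℕ) : Bm b m = fun u => ∑' j, rateWithout b m j * u ^ j := by
  ext u
  refine tsum_congr fun j => ?_
  unfold rateWithout
  split_ifs <;> simp

lemma IsBranchingRate.hasSum_Bm (hb : IsBranchingRate b) (m : ℕ) {u : ℝ}
    (hu : u ∈ Icc (0 : ℝ) 1) : HasSum (fun j => rateWithout b m j * u ^ j) (Bm b m u) := by
  rw [Bm_eq]
  refine Summable.hasSum ?_
  refine Summable.of_norm_bounded hb.hasSum_zero.summable.norm fun j => ?_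
  rw [norm_mul]
  refine (mul_le_of_le_one_right (norm_nonneg _) ?_).trans (norm_rateWithout_le b m j)
  rw [norm_pow, Real.norm_of_nonneg hu.1]
  exact pow_le_one₀ hu.1 hu.2

lemma IsBranchingRate.B_eq (hb : IsBranchingRate b) (m : ℕ) {u : ℝ} (hu : u ∈ Icc (0 : ℝ) 1) :
    B b u = Bm b m u + b m * u ^ m := by
  refine (hb.hasSum_B hu).unique ?_
  convert (hb.hasSum_Bm m hu).add (hasSum_ite_eq m (b m * u ^ m)) using 2 with j
  unfold rateWithout
  split_ifs with hj <;> simp [hj]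

lemma IsBranchingRate.B_one (hb : IsBranchingRate b) : B b 1 = 0 := by
  refine (hb.hasSum_B (by simp)).unique ?_
  simpa using hb.hasSum_zero

lemma continuousOn_tsum_pow {β : ℕ → ℝ} (h : Summable fun j => ‖β j‖) :
    ContinuousOn (fun u : ℝ => ∑' j, β j * u ^ j) (Icc 0 1) := by
  refine continuousOn_tsum (fun j => by fun_prop) h fun j u hu => ?_
  rw [norm_mul]
  refine mul_le_of_le_one_right (norm_nonneg _) ?_
  rw [norm_pow, Real.norm_of_nonneg hu.1]
  exact pow_le_one₀ hu.1 hu.2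

lemma IsBranchingRate.continuousOn_B (hb : IsBranchingRate b) : ContinuousOn (B b) (Icc 0 1) :=
  continuousOn_tsum_pow hb.hasSum_zero.summable.norm

lemma IsBranchingRate.summable_rateWithout (hb : IsBranchingRate b) (m : ℕ) :
    Summable fun j => ‖rateWithout b m j‖ :=
  Summable.of_nonneg_of_le (fun _ => norm_nonneg _) (norm_rateWithout_le b m)
    hb.hasSum_zero.summable.norm

lemma IsBranchingRate.continuousOn_Bm (hb : IsBranchingRate b) (m : ℕ) :
    ContinuousOn (Bm b m) (Icc 0 1) := by
  rw [Bm_eq]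
  exact continuousOn_tsum_pow (hb.summable_rateWithout m)

/-- The intermediate value theorem gives a root in [0, u], and compactness a least one there; any
smaller nonnegative root would also lie in [0, u]. Values of f beyond 1 play no role, so the default
value 0 of a divergent sum defining B or B_m cannot disturb the minimal root. -/
lemma exists_isLeast_root {f : ℝ → ℝ} (hf : ContinuousOn f (Icc 0 1)) (h0 : 0 < f 0) {u : ℝ}
    (hu : u ∈ Icc (0 : ℝ) 1) (hfu : f u ≤ 0) :
    ∃ x, IsLeast {u : ℝ | 0 ≤ u ∧ f u = 0} x ∧ 0 < x ∧ x ≤ u := by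
  have hc : ContinuousOn f (Icc 0 u) := hf.mono (Icc_subset_Icc_right hu.2)
  obtain ⟨y, hy, hfy⟩ := intermediate_value_Icc' hu.1 hc ⟨hfu, h0.le⟩
  have hK : IsCompact (Icc 0 u ∩ f ⁻¹' {0}) :=
    isCompact_Icc.of_isClosed_subset
      (hc.preimage_isClosed_of_isClosed isClosed_Icc isClosed_singleton) inter_subset_left
  obtain ⟨x, hx, hx'⟩ := hK.exists_isLeast ⟨y, hy, hfy⟩
  refine ⟨x, ⟨⟨hx.1.1, hx.2⟩, fun z hz => ?_⟩, lt_of_le_of_ne hx.1.1 ?_, hx.1.2⟩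
  · by_contra! hzx
    exact hzx.not_ge (hx' ⟨⟨hz.1, hzx.le.trans hx.1.2⟩, hz.2⟩)
  · rintro rfl
    exact h0.ne' hx.2

/-- Termwise differentiation on a ball of radius q with z < q < 1: the coefficients are bounded, so
C i q^(i-1) is a summable majorant. At z = 1 it could fail, since the rates need not have a finite
mean. -/
lemma IsBranchingRate.hasSum_deriv_Bm (hb : IsBranchingRate b) (m : ℕ) {z : ℝ} (hz0 : 0 ≤ z)
    (hz1 : z < 1) :
    HasSum (fun i => rateWithout b m i * (i * z ^ (i - 1))) (deriv (Bm b m) z) := by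
  obtain ⟨q, hzq, hq1⟩ := exists_between hz1
  have hq0 : 0 ≤ q := hz0.trans hzq.le
  obtain ⟨C, hC⟩ : ∃ C, ∀ j, ‖rateWithout b m j‖ ≤ C :=
    ⟨∑' j, ‖rateWithout b m j‖, fun j => (hb.summable_rateWithout m).le_tsum j
      fun _ _ => norm_nonneg _⟩
  have hsum : Summable fun i : ℕ => C * (i * q ^ (i - 1)) := by
    refine Summable.mul_left _ ?_
    rw [← summable_nat_add_iff 1]
    have h1 := summable_pow_mul_geometric_of_norm_lt_one 1
      (show ‖q‖ < 1 by rwa [Real.norm_of_nonneg hq0])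
    have h2 := summable_geometric_of_lt_one hq0 hq1
    refine (h1.add h2).congr fun i => ?_
    simp only [Nat.add_sub_cancel, pow_one]
    push_cast
    ring
  have hbd : ∀ (i : ℕ) (y : ℝ), y ∈ Metric.ball (0 : ℝ) q →
      ‖rateWithout b m i * (i * y ^ (i - 1))‖ ≤ C * (i * q ^ (i - 1)) := by
    intro i y hy
    rw [mem_ball_zero_iff] at hy
    rw [norm_mul, norm_mul, norm_pow, Real.norm_of_nonneg (Nat.cast_nonneg i)]
    have hC0 : 0 ≤ C := (norm_nonneg _).trans (hC i)
    gcongr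
    exact hC i
  have hzb : z ∈ Metric.ball (0 : ℝ) q := by
    rwa [mem_ball_zero_iff, Real.norm_of_nonneg hz0]
  have hd := hasDerivAt_tsum_of_isPreconnected (g := fun i y => rateWithout b m i * y ^ i)
    (g' := fun i y => rateWithout b m i * (i * y ^ (i - 1))) hsum Metric.isOpen_ball
    (convex_ball (0 : ℝ) q).isPreconnected (fun i y _ => (hasDerivAt_pow i y).const_mul _) hbd hzb
    (hb.hasSum_Bm m ⟨hz0, hz1.le⟩).summable hzb
  rw [Bm_eq, hd.deriv]
  exact (Summable.of_norm_bounded hsum fun i => hbd i z hzb).hasSum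

end Analytic

/-! ### Construction of the recursive sequence -/

section Recursion

lemma convPow_one (r : ℕ → ℝ) (l : ℕ) : convPow r 1 l = r l := by
  rw [convPow, Finset.Nat.antidiagonalTuple_one]
  simp

lemma restrictedConvPow_one (r : ℕ → ℝ) (k : ℕ) : restrictedConvPow r 1 k = 0 := by
  have h := convPow_succ_eq r k 1
  rw [convPow_one] at h
  simpa using h

/-- The exclusion of i = 1 costs nothing: a single index equal to k + 1 is never at most k, so that
restricted sum is empty. -/
lemma recTerm_eq (b : ℕ → ℝ) (m : ℕ) (r : ℕ → ℝ) (k i : ℕ) :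
    recTerm b m r k i = rateWithout b m i * restrictedConvPow r i k := by
  unfold recTerm rateWithout
  by_cases h1 : i = 1
  · simp [h1, restrictedConvPow_one]
  · simp only [h1, false_or]
    split_ifs <;> simp

/-- The right-hand side of the recursion. -/
noncomputable def recStep (b : ℕ → ℝ) (m : ℕ) (D : ℝ) (r : ℕ → ℝ) (k : ℕ) : ℝ :=
  -((∑' i, recTerm b m r k i) + b m * convPow r m k) / D

/-- The solution of the recursion up to the index `k`, continued by zero. -/
noncomputable def recSeqAux (b : ℕ → ℝ) (m : ℕ) (z D : ℝ) : ℕ → ℕ → ℝ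
  | 0 => fun l => if l = 0 then z else 0
  | k + 1 => Function.update (recSeqAux b m z D k) (k + 1)
      (recStep b m D (recSeqAux b m z D k) k)

/-- The solution of the recursion with initial value `z`. -/
noncomputable def recSeq (b : ℕ → ℝ) (m : ℕ) (z D : ℝ) (l : ℕ) : ℝ := recSeqAux b m z D l l

lemma recSeqAux_eq_zero (b : ℕ → ℝ) (m : ℕ) (z D : ℝ) {k l : ℕ} (h : k < l) :
    recSeqAux b m z D k l = 0 := by
  induction k with
  | zero => simp [recSeqAux]; omega
  | succ k ih =>
    rw [recSeqAux, Function.update_of_ne (by omega), ih (by omega)]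

lemma recSeqAux_eq (b : ℕ → ℝ) (m : ℕ) (z D : ℝ) {k l : ℕ} (h : l ≤ k) :
    recSeqAux b m z D k l = recSeq b m z D l := by
  induction k, h using Nat.le_induction with
  | base => rfl
  | succ k hk ih => rw [recSeqAux, Function.update_of_ne (by omega), ih]

lemma recSeqAux_eq_cutoff (b : ℕ → ℝ) (m : ℕ) (z D : ℝ) (k : ℕ) :
    recSeqAux b m z D k = cutoff (recSeq b m z D) k := by
  ext l
  unfold cutoff
  split_ifs with h
  exacts [recSeqAux_eq b m z D h, recSeqAux_eq_zero b m z D (by omega)]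

lemma recSeq_zero (b : ℕ → ℝ) (m : ℕ) (z D : ℝ) : recSeq b m z D 0 = z := by
  simp [recSeq, recSeqAux]

lemma cutoff_cutoff (r : ℕ → ℝ) (k : ℕ) : cutoff (cutoff r k) k = cutoff r k := by
  ext l
  unfold cutoff
  split_ifs <;> rfl

/-- The right-hand side of the recursion reads its sequence only up to index k, so it does not
distinguish the finite approximation from the full sequence. -/
lemma recSeq_succ (b : ℕ → ℝ) (m : ℕ) (z D : ℝ) (k : ℕ) :
    recSeq b m z D (k + 1) = recStep b m D (recSeq b m z D) k := by
  conv_lhs => rw [recSeq, recSeqAux, Function.update_self, recSeqAux_eq_cutoff]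
  unfold recStep
  simp only [recTerm_eq, restrictedConvPow_eq, cutoff_cutoff]
  rw [convPow_congr (r := cutoff (recSeq b m z D) k) (s := recSeq b m z D)
    (fun a ha => by simp [cutoff, ha])]

end Recursion

lemma hasSum_of_eq {ι : Type*} {f g : ι → ℝ} {a : ℝ} (h : ∀ i, f i = g i) (hg : HasSum g a) :
    HasSum f a := by
  rwa [funext h]

/-! ### The power series solution of B_m(u) + b_m v u^m = 0 -/

section Solution

lemma cutoff_nonneg {r : ℕ → ℝ} {k : ℕ} (h : ∀ l ≤ k, 0 ≤ r l) (l : ℕ) : 0 ≤ cutoff r k l := by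
  unfold cutoff
  split_ifs with hl
  exacts [h l hl, le_rfl]

lemma hasSum_cutoff (r : ℕ → ℝ) (k : ℕ) :
    HasSum (fun l => cutoff r k l * 1 ^ l) (∑ l ∈ Finset.range (k + 1), r l) := by
  have h := hasSum_sum_of_ne_finset_zero (L := SummationFilter.unconditional ℕ)
    (f := fun l => cutoff r k l * 1 ^ l)
    (s := Finset.range (k + 1)) (fun l hl => by
      rw [Finset.mem_range] at hl
      simp [cutoff]
      omega)
  convert h using 1
  refine Finset.sum_congr rfl fun l hl => ?_
  rw [Finset.mem_range] at hl
  simp [cutoff, show l ≤ k by omega]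

/-- These are some of the nonnegative coefficients of the j-th power of the polynomial ∑_{l ≤ k} r_l
v^l, evaluated at v = 1. -/
lemma sum_convPow_cutoff_le {r : ℕ → ℝ} {k : ℕ} (h : ∀ l ≤ k, 0 ≤ r l) (j : ℕ) (s : Finset ℕ) :
    ∑ l ∈ s, convPow (cutoff r k) j l ≤ (∑ l ∈ Finset.range (k + 1), r l) ^ j := by
  have h1 := hasSum_convPow (hasSum_cutoff r k) j
  simp only [one_pow, mul_one] at h1
  exact sum_le_hasSum s (fun l _ => convPow_nonneg (cutoff_nonneg h) j l) h1

variable {b : ℕ → ℝ} {m : ℕ} {r : ℕ → ℝ} {ρ D : ℝ}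

lemma summable_recTerm (hb : IsBranchingRate b) {k : ℕ} (h : ∀ l ≤ k, 0 ≤ r l)
    (hs : ∑ l ∈ Finset.range (k + 1), r l ≤ 1) : Summable (recTerm b m r k) := by
  refine Summable.of_norm_bounded (hb.summable_rateWithout m) fun i => ?_
  rw [recTerm_eq, norm_mul]
  refine mul_le_of_le_one_right (norm_nonneg _) ?_
  rw [restrictedConvPow_eq, Real.norm_of_nonneg (convPow_nonneg (cutoff_nonneg h) _ _)]
  refine le_trans ?_ (pow_le_one₀ (n := i) (Finset.sum_nonneg fun l hl => h l ?_) hs)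
  · simpa using sum_convPow_cutoff_le h i {k + 1}
  · rw [Finset.mem_range] at hl; omega

lemma recTerm_nonneg (hb : IsBranchingRate b) {k : ℕ} (h : ∀ l ≤ k, 0 ≤ r l) (i : ℕ) :
    0 ≤ recTerm b m r k i := by
  unfold recTerm
  split_ifs with hi
  · rfl
  · rw [restrictedConvPow_eq]
    exact mul_nonneg (hb.nonneg i (by tauto)) (convPow_nonneg (cutoff_nonneg h) _ _)

/-- The coefficient of `v ^ l` in `b_m v R(v) ^ m`. -/
noncomputable def shiftedTerm (b : ℕ → ℝ) (m : ℕ) (r : ℕ → ℝ) : ℕ → ℝ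
  | 0 => 0
  | l + 1 => b m * convPow r m l

/-- The recursion step, multiplied by D, is the coefficient of v^(k+1) in B_m(R(v)) = -b_m v R(v)^m.
-/
lemma hasSum_convPow_succ
    (hD : HasSum (fun i => rateWithout b m i * (i * r 0 ^ (i - 1))) D) (hD0 : D < 0) {k : ℕ}
    (hs : Summable (recTerm b m r k)) (hrk : r (k + 1) = recStep b m D r k) :
    HasSum (fun i => rateWithout b m i * convPow r i (k + 1)) (-shiftedTerm b m r (k + 1)) := by
  have h := (hD.mul_right (r (k + 1))).add hs.hasSum
  have e : -shiftedTerm b m r (k + 1) = D * r (k + 1) + ∑' i, recTerm b m r k i := by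
    rw [hrk, recStep, mul_div_cancel₀ _ hD0.ne, shiftedTerm]
    ring
  rw [e]
  refine hasSum_of_eq (fun i => ?_) h
  rw [convPow_succ_eq, recTerm_eq]
  ring

/-- Convexity: a chord to the right of z is at least as steep as the tangent at z. The possibly
negative coefficient at i = 1 belongs to a linear term, for which equality holds. -/
lemma Bm_sub_le (hb : IsBranchingRate b) {z : ℝ} (hz : 0 ≤ z)
    (hD : HasSum (fun i => rateWithout b m i * (i * z ^ (i - 1))) D) {x y : ℝ} (hzy : z ≤ y)
    (hyx : y ≤ x) (hx : x ≤ 1) : D * (x - y) ≤ Bm b m x - Bm b m y := by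
  refine hasSum_le (fun i => ?_) (hD.mul_right (x - y))
    ((hb.hasSum_Bm m ⟨hz.trans (hzy.trans hyx), hx⟩).sub
      (hb.hasSum_Bm m ⟨hz.trans hzy, hyx.trans hx⟩))
  rw [mul_assoc, ← mul_sub]
  by_cases hi : i = 1
  · simp [hi]
  · exact mul_le_mul_of_nonneg_left (mul_pow_mul_sub_le_pow_sub_pow hz hzy hyx i)
      (hb.rateWithout_nonneg m hi)

/-- A solution of the recursion is nonnegative, its partial sums are bounded by the root `ρ` of
`B`, and it solves `B_m(R(v)) + b_m v R(v) ^ m = 0` coefficientwise. -/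
lemma solution_induction (hb : IsBranchingRate b) (hm : 1 < m)
    (hr0 : 0 ≤ r 0) (hr0B : Bm b m (r 0) = 0) (hρ : r 0 ≤ ρ) (hρ1 : ρ ≤ 1) (hρB : B b ρ = 0)
    (hD : HasSum (fun i => rateWithout b m i * (i * r 0 ^ (i - 1))) D) (hD0 : D < 0)
    (hrk : ∀ k, r (k + 1) = recStep b m D r k) (k : ℕ) :
    (∀ l ≤ k, 0 ≤ r l ∧
      HasSum (fun i => rateWithout b m i * convPow r i l) (-shiftedTerm b m r l)) ∧
    ∑ l ∈ Finset.range (k + 1), r l ≤ ρ := by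
  have hbm : 0 ≤ b m := hb.nonneg m (by omega)
  induction k with
  | zero =>
    refine ⟨fun l hl => ?_, by simpa using hρ⟩
    obtain rfl : l = 0 := by omega
    refine ⟨hr0, ?_⟩
    simp only [convPow_zero_right, shiftedTerm, neg_zero]
    rw [← hr0B]
    exact hb.hasSum_Bm m ⟨hr0, hρ.trans hρ1⟩
  | succ k ih =>
    obtain ⟨ih1, ih2⟩ := ih
    have hnn : ∀ l ≤ k, 0 ≤ r l := fun l hl => (ih1 l hl).1
    set s := ∑ l ∈ Finset.range (k + 1), r l with hs
    have hs0 : r 0 ≤ s := by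
      refine Finset.single_le_sum (f := r) (fun l hl => hnn l ?_) (by simp)
      rw [Finset.mem_range] at hl; omega
    have hsI : s ∈ Icc (0 : ℝ) 1 := ⟨hr0.trans hs0, ih2.trans hρ1⟩
    have hsum := summable_recTerm (m := m) hb hnn (ih2.trans hρ1)
    have hE := hasSum_convPow_succ hD hD0 hsum (hrk k)
    have hconv : ∀ l ≤ k, 0 ≤ convPow r m l := fun l hl => by
      rw [convPow_congr (s := cutoff r k) (fun a ha => by simp [cutoff]; omega)]
      exact convPow_nonneg (cutoff_nonneg hnn) _ _
    have hpos : 0 ≤ r (k + 1) := by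
      rw [hrk, recStep]
      refine div_nonneg_of_nonpos (neg_nonpos.2 (add_nonneg ?_ ?_)) hD0.le
      · exact tsum_nonneg fun i => recTerm_nonneg hb hnn i
      · exact mul_nonneg hbm (hconv k le_rfl)
    have hall : ∀ l ≤ k + 1, 0 ≤ r l ∧
        HasSum (fun i => rateWithout b m i * convPow r i l) (-shiftedTerm b m r l) := by
      intro l hl
      rcases Nat.lt_or_ge k l with h | h
      · obtain rfl : l = k + 1 := by omega
        exact ⟨hpos, hE⟩
      · exact ih1 l h
    refine ⟨hall, ?_⟩
    -- The coefficient equations of orders 0, …, k + 1 are added up, to be compared with the values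
    -- of B_m and b_m u^m at the partial sum s.
    have htot : HasSum
        (fun i => ∑ l ∈ Finset.range (k + 2), rateWithout b m i * convPow r i l)
        (∑ l ∈ Finset.range (k + 2), -shiftedTerm b m r l) :=
      hasSum_sum fun l hl => (hall l (by rw [Finset.mem_range] at hl; omega)).2
    have hcut : ∀ i, ∑ l ∈ Finset.range (k + 2), convPow r i l =
        i * r 0 ^ (i - 1) * r (k + 1) +
          ∑ l ∈ Finset.range (k + 2), convPow (cutoff r k) i l := by
      intro i
      rw [Finset.sum_range_succ, Finset.sum_range_succ _ (k + 1), convPow_succ_eq, restrictedConvPow_eq]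
      have : ∑ l ∈ Finset.range (k + 1), convPow r i l =
          ∑ l ∈ Finset.range (k + 1), convPow (cutoff r k) i l := by
        refine Finset.sum_congr rfl fun l hl => convPow_congr (fun a ha => ?_) i
        rw [Finset.mem_range] at hl
        simp [cutoff]; omega
      rw [this]
      ring
    have hle : ∑ l ∈ Finset.range (k + 2), -shiftedTerm b m r l ≤
        D * r (k + 1) + Bm b m s := by
      refine hasSum_le (fun i => ?_) htot
        ((hD.mul_right (r (k + 1))).add (hb.hasSum_Bm m hsI))
      rw [← Finset.mul_sum, hcut, mul_add, mul_assoc (rateWithout b m i)]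
      refine add_le_add le_rfl ?_
      -- The coefficient at i = 1 may be negative, so an inequality would not do; here the truncated
      -- sum is exactly s.
      by_cases hi : i = 1
      · subst hi
        rw [Finset.sum_congr rfl fun l _ => convPow_one (cutoff r k) l, pow_one, hs]
        refine le_of_eq (congrArg _ ?_)
        rw [Finset.sum_range_succ]
        simp only [cutoff, show ¬ (k + 1 ≤ k) by omega, if_false, add_zero]
        refine Finset.sum_congr rfl fun l hl => ?_
        rw [Finset.mem_range] at hl
        simp; omega
      · exact mul_le_mul_of_nonneg_left (sum_convPow_cutoff_le hnn i _)
          (hb.rateWithout_nonneg m hi)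
    have hshift : ∑ l ∈ Finset.range (k + 2), shiftedTerm b m r l ≤ b m * s ^ m := by
      rw [Finset.sum_range_succ', shiftedTerm, add_zero]
      simp only [shiftedTerm]
      rw [← Finset.mul_sum]
      refine mul_le_mul_of_nonneg_left ?_ hbm
      rw [Finset.sum_congr rfl fun l hl => convPow_congr (s := cutoff r k) (fun a ha => by
        rw [Finset.mem_range] at hl; simp [cutoff]; omega) m]
      exact sum_convPow_cutoff_le hnn m _
    rw [Finset.sum_neg_distrib] at hle
    have hconvex := Bm_sub_le hb hr0 hD hs0 ih2 hρ1
    have hpow : b m * s ^ m ≤ b m * ρ ^ m :=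
      mul_le_mul_of_nonneg_left (pow_le_pow_left₀ hsI.1 ih2 m) hbm
    have hBρ := hb.B_eq m ⟨hr0.trans hρ, hρ1⟩
    rw [hρB] at hBρ
    rw [Finset.sum_range_succ, ← hs]
    -- The bounds combine to -b_m s^m ≤ D r_(k+1) + B_m(s) ≤ D (r_(k+1) + s - ρ) - b_m ρ^m, using
    -- B_m(ρ) = -b_m ρ^m. Since s ≤ ρ, the product D (r_(k+1) + s - ρ) is nonnegative, and D < 0.
    by_contra! hlt
    nlinarith

/-- The generating function of a nonnegative summable coefficientwise solution of
`B_m(R(v)) + b_m v R(v) ^ m = 0` is a solution. -/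
lemma hasSum_rate_mul_pow (hb : IsBranchingRate b) (hr : ∀ l, 0 ≤ r l) {s : ℝ} (hs : HasSum r s)
    (hs1 : s ≤ 1)
    (hE : ∀ l, HasSum (fun i => rateWithout b m i * convPow r i l) (-shiftedTerm b m r l))
    {v R : ℝ} (hv : v ∈ Icc (0 : ℝ) 1) (hR : HasSum (fun l => r l * v ^ l) R) :
    HasSum (fun i => rateWithout b m i * R ^ i) (-(b m * v * R ^ m)) := by
  have hRs : R ≤ s := hasSum_le (fun l => mul_le_of_le_one_right (hr l)
    (pow_le_one₀ hv.1 hv.2)) hR hs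
  have hR0 : 0 ≤ R := hR.nonneg fun l => mul_nonneg (hr l) (pow_nonneg hv.1 l)
  have hrow : ∀ i, HasSum (fun l => rateWithout b m i * (convPow r i l * v ^ l))
      (rateWithout b m i * R ^ i) := fun i => (hasSum_convPow hR i).mul_left _
  -- Absolute summability of the double series, with majorant |β_i| R^i over the rows, where β is
  -- `rateWithout b m`; it allows summing by rows and by columns.
  have hsumm : Summable fun x : ℕ × ℕ => rateWithout b m x.1 * (convPow r x.1 x.2 * v ^ x.2) := by
    have hrow' : ∀ i, HasSum (fun l => ‖rateWithout b m i * (convPow r i l * v ^ l)‖)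
        (‖rateWithout b m i‖ * R ^ i) := fun i => by
      refine hasSum_of_eq (fun l => ?_) ((hasSum_convPow hR i).mul_left _)
      rw [norm_mul, Real.norm_of_nonneg (mul_nonneg (convPow_nonneg hr _ _) (pow_nonneg hv.1 _))]
    refine Summable.of_norm ((summable_prod_of_nonneg fun x => norm_nonneg _).2
      ⟨fun i => (hrow' i).summable, ?_⟩)
    simp only [(hrow' _).tsum_eq]
    refine Summable.of_nonneg_of_le
      (fun i => mul_nonneg (norm_nonneg _) (pow_nonneg hR0 i)) (fun i => ?_)
      (hb.summable_rateWithout m)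
    exact mul_le_of_le_one_right (norm_nonneg _) (pow_le_one₀ hR0 (hRs.trans hs1))
  have h1 := hsumm.hasSum.prod_fiberwise hrow
  have hcol : ∀ l, HasSum (fun i => rateWithout b m i * (convPow r i l * v ^ l))
      (-shiftedTerm b m r l * v ^ l) := fun l => by
    refine hasSum_of_eq (fun i => ?_) ((hE l).mul_right (v ^ l))
    ring
  have h2 := (hsumm.prod_symm.hasSum).prod_fiberwise hcol
  have h3 : HasSum (fun l => -shiftedTerm b m r l * v ^ l) (-(b m * v * R ^ m)) := by
    rw [← hasSum_nat_add_iff' 1]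
    simp only [shiftedTerm, Finset.sum_range_one, neg_zero, zero_mul, sub_zero]
    have h := (hasSum_convPow hR m).mul_left (-(b m * v))
    rw [neg_mul] at h
    refine hasSum_of_eq (fun l => ?_) h
    rw [pow_succ]; ring
  have h4 := h2.unique h3
  rw [← h4]
  convert h1 using 1
  exact (Equiv.prodComm ℕ ℕ).tsum_eq
    (fun x : ℕ × ℕ => rateWithout b m x.1 * (convPow r x.1 x.2 * v ^ x.2))

/-- The two minimal roots are located by signs: B_m is positive at 0, equals -b_m ρ^m < 0 at ρ, and
equals -b_m < 0 at 1. The last clause is what the probabilistic part consumes; the bound u < 1 in it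
provides decay in the state. -/
theorem exists_solution (hb : IsBranchingRate b) (hb0 : 0 < b 0) (hm : 1 < m) (hbm : 0 < b m) :
    ∃ (ρ : ℝ) (r : ℕ → ℝ),
      IsLeast {u : ℝ | 0 ≤ u ∧ B b u = 0} ρ ∧ 0 < ρ ∧
      IsLeast {u : ℝ | 0 ≤ u ∧ Bm b m u = 0} (r 0) ∧
      deriv (Bm b m) (r 0) < 0 ∧
      r 1 = -(b m * r 0 ^ m) / deriv (Bm b m) (r 0) ∧
      (∀ k, 1 ≤ k → Summable (recTerm b m r k) ∧
        r (k + 1) = -((∑' i, recTerm b m r k i) + b m * convPow r m k) /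
          deriv (Bm b m) (r 0)) ∧
      HasSum r ρ ∧
      ∀ v, 0 ≤ v → v < 1 → ∃ u, 0 < u ∧ u < 1 ∧ HasSum (fun k => r k * v ^ k) u ∧
        HasSum (fun i => (if i = m then v else 1) * (b i * u ^ i)) 0 := by
  have hI1 : (1 : ℝ) ∈ Icc (0 : ℝ) 1 := ⟨zero_le_one, le_rfl⟩
  have hI0 : (0 : ℝ) ∈ Icc (0 : ℝ) 1 := ⟨le_rfl, zero_le_one⟩
  have hB0 : B b 0 = b 0 := (hb.hasSum_B hI0).unique (by
    refine hasSum_of_eq (fun j => ?_) (hasSum_ite_eq (0 : ℕ) (b 0))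
    split_ifs with hj <;> simp [hj])
  have hBm0 : Bm b m 0 = b 0 := by
    rw [← hB0, hb.B_eq m hI0, zero_pow (by omega)]
    simp
  obtain ⟨ρ, hρ, hρ0, hρ1⟩ := exists_isLeast_root hb.continuousOn_B (by rwa [hB0]) hI1 hb.B_one.le
  have hρI : ρ ∈ Icc (0 : ℝ) 1 := ⟨hρ0.le, hρ1⟩
  have hBmρ : Bm b m ρ < 0 := by
    have h1 := hb.B_eq m hρI
    have h2 : 0 < b m * ρ ^ m := mul_pos hbm (pow_pos hρ0 m)
    rw [hρ.1.2] at h1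
    linarith
  obtain ⟨z, hz, hz0, hzρ⟩ :=
    exists_isLeast_root (hb.continuousOn_Bm m) (by rwa [hBm0]) hρI hBmρ.le
  have hBm1 : Bm b m 1 < 0 := by
    have h1 := hb.B_eq m hI1
    rw [hb.B_one, one_pow, mul_one] at h1
    linarith
  have hz1 : z < 1 := by
    refine lt_of_le_of_ne (hzρ.trans hρ1) ?_
    rintro rfl
    exact hBm1.ne hz.1.2
  set D := deriv (Bm b m) z with hDdef
  have hD := hb.hasSum_deriv_Bm m hz0.le hz1
  rw [← hDdef] at hD
  -- Convexity between z and 1 gives D (1 - z) ≤ B_m(1) < 0.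
  have hD0 : D < 0 := by
    have h1 := Bm_sub_le hb hz0.le hD le_rfl hz1.le le_rfl
    rw [hz.1.2, sub_zero] at h1
    by_contra! h2
    nlinarith [mul_nonneg h2 (sub_nonneg.2 hz1.le)]
  set r := recSeq b m z D with hr
  have hr0 : r 0 = z := recSeq_zero b m z D
  have hrk : ∀ k, r (k + 1) = recStep b m D r k := recSeq_succ b m z D
  have hind := solution_induction hb hm (r := r) (ρ := ρ) (D := D) (by rw [hr0]; exact hz0.le)
    (by rw [hr0]; exact hz.1.2) (by rw [hr0]; exact hzρ) hρ1 hρ.1.2 (by rwa [hr0]) hD0 hrk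
  have hnn : ∀ l, 0 ≤ r l := fun l => ((hind l).1 l le_rfl).1
  have hE := fun l => ((hind l).1 l le_rfl).2
  have hsumm : Summable r := by
    refine summable_of_sum_range_le hnn (c := ρ) fun n => ?_
    refine le_trans ?_ (hind n).2
    exact Finset.sum_le_sum_of_subset_of_nonneg (Finset.range_mono (Nat.le_succ n))
      fun l _ _ => hnn l
  have hsρ : ∑' l, r l ≤ ρ := by
    refine hsumm.tsum_le_of_sum_range_le fun n => ?_
    refine le_trans ?_ (hind n).2
    exact Finset.sum_le_sum_of_subset_of_nonneg (Finset.range_mono (Nat.le_succ n))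
      fun l _ _ => hnn l
  have hs0 : 0 ≤ ∑' l, r l := tsum_nonneg hnn
  have hroot : ∀ {v R : ℝ}, v ∈ Icc (0 : ℝ) 1 → HasSum (fun l => r l * v ^ l) R →
      HasSum (fun i => rateWithout b m i * R ^ i) (-(b m * v * R ^ m)) := fun hv hR =>
    hasSum_rate_mul_pow hb hnn hsumm.hasSum (hsρ.trans hρ1) hE hv hR
  -- At v = 1 the sum of the series is a root of B that is at most ρ, hence equal to it.
  have hsum : HasSum r ρ := by
    have h1 := hroot (v := 1) hI1 (by simpa using hsumm.hasSum)
    have h2 : B b (∑' l, r l) = 0 := by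
      rw [hb.B_eq m ⟨hs0, hsρ.trans hρ1⟩, (hb.hasSum_Bm m ⟨hs0, hsρ.trans hρ1⟩).unique h1]
      ring
    rw [← le_antisymm hsρ (hρ.2 ⟨hs0, h2⟩)]
    exact hsumm.hasSum
  have hr1 : r 1 = -(b m * r 0 ^ m) / D := by
    rw [hrk 0, recStep, convPow_zero_right]
    -- For k = 0 all indices would be 0 while their sum is 1, so the formula for r 1 is the general
    -- step without the series.
    have : ∀ i, recTerm b m r 0 i = 0 := fun i => by
      unfold recTerm restrictedConvPow
      split_ifs
      · rfl
      · rw [Finset.filter_eq_empty_iff.2, Finset.sum_empty, mul_zero]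
        intro x hx h
        rw [Finset.Nat.mem_antidiagonalTuple, Finset.sum_eq_zero fun a _ => by
          have := h a; omega] at hx
        omega
    simp only [this, tsum_zero, zero_add]
  -- Positivity of r 1 makes R(v) < R(1) = ρ ≤ 1 strict for v < 1.
  have hr1pos : 0 < r 1 := by
    rw [hr1]
    refine div_pos_of_neg_of_neg (neg_neg_of_pos (mul_pos hbm (pow_pos ?_ m))) hD0
    rwa [hr0]
  refine ⟨ρ, r, hρ, hρ0, by rwa [hr0], by rwa [hr0], by rw [hr1, hr0], fun k _ => ⟨?_, ?_⟩, hsum,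
    fun v hv0 hv1 => ?_⟩
  · exact summable_recTerm hb (fun l _ => hnn l) ((hind k).2.trans hρ1)
  · rw [hrk, recStep, hr0]
  · have hle : ∀ l, r l * v ^ l ≤ r l := fun l =>
      mul_le_of_le_one_right (hnn l) (pow_le_one₀ hv0 hv1.le)
    have hvs : Summable fun l => r l * v ^ l :=
      Summable.of_nonneg_of_le (fun l => mul_nonneg (hnn l) (pow_nonneg hv0 l)) hle hsumm
    have hlt : ∑' l, r l * v ^ l < ρ := by
      refine hasSum_lt (i := 1) hle ?_ hvs.hasSum hsum
      rw [pow_one]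
      exact mul_lt_of_lt_one_right hr1pos hv1
    refine ⟨∑' l, r l * v ^ l, ?_, hlt.trans_le hρ1, hvs.hasSum, ?_⟩
    · refine hvs.tsum_pos (fun l => mul_nonneg (hnn l) (pow_nonneg hv0 l)) 0 ?_
      rwa [pow_zero, mul_one, hr0]
    · have h := (hroot ⟨hv0, hv1.le⟩ hvs.hasSum).add
        (hasSum_ite_eq m (b m * v * (∑' l, r l * v ^ l) ^ m))
      rw [neg_add_cancel] at h
      refine hasSum_of_eq (fun i => ?_) h
      unfold rateWithout
      split_ifs with hi
      · rw [hi]; ring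
      · ring

end Solution

/-! ### Regular paths and the counting of their crossings -/

section Path

variable {x : ℝ≥0 → ℕ} {m : ℕ}

lemma IsRegularPath.eventually_right (hx : IsRegularPath x) (t : ℝ≥0) :
    ∀ᶠ s in 𝓝[≥] t, x s = x t := by
  have h := hx.right_continuous t
  rw [ContinuousWithinAt, nhds_discrete, tendsto_pure] at h
  exact h

lemma IsRegularPath.exists_open (hx : IsRegularPath x) (t : ℝ≥0) :
    ∃ U : Set ℝ≥0, IsOpen U ∧ t ∈ U ∧ (∀ s ∈ U, t ≤ s → x s = x t) ∧
      ∃ a, ∀ s ∈ U, s < t → x s = a := by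
  obtain ⟨U, hU, htU, hUr⟩ := eventually_nhdsWithin_iff.1 (hx.eventually_right t)
    |> eventually_nhds_iff.1 |> fun ⟨U, h1, h2, h3⟩ => (⟨U, h2, h3, h1⟩ :
      ∃ U : Set ℝ≥0, IsOpen U ∧ t ∈ U ∧ ∀ s ∈ U, s ∈ Ici t → x s = x t)
  rcases eq_or_ne t 0 with rfl | ht
  · exact ⟨U, hU, htU, hUr, 0, fun s _ hs => absurd hs not_lt_zero⟩
  · obtain ⟨a, ha⟩ := hx.left_limit t (pos_iff_ne_zero.2 ht)
    rw [nhds_discrete, tendsto_pure] at ha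
    obtain ⟨V, hV1, hV, htV⟩ := eventually_nhds_iff.1 (eventually_nhdsWithin_iff.1 ha)
    exact ⟨U ∩ V, hU.inter hV, ⟨htU, htV⟩, fun s hs => hUr s hs.1, a, fun s hs => hV1 s hs.2⟩

/-- The path has at most one jump in `(a, b]`. -/
def SingleJump (x : ℝ≥0 → ℕ) (a b : ℝ≥0) : Prop :=
  ∃ t, a < t ∧ t ≤ b ∧ (∀ s, a ≤ s → s < t → x s = x a) ∧ ∀ s, t ≤ s → s ≤ b → x s = x b

/-- Each time has a neighbourhood in which the path is constant on either side of it. By a Lebesgue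
number for [0, T], a short interval lies in one such neighbourhood, whose centre is the only
possible jump time. If the centre is not in (a, b], the path is constant and b serves as nominal
jump time. -/
lemma IsRegularPath.exists_singleJump (hx : IsRegularPath x) (T : ℝ≥0) :
    ∃ δ > 0, ∀ a b, a < b → b ≤ T → dist b a < δ → SingleJump x a b := by
  choose U hU htU hr a ha using hx.exists_open
  obtain ⟨δ, hδ, h⟩ := lebesgue_number_lemma_of_metric (isCompact_Icc (a := (0 : ℝ≥0)) (b := T)) hU
    (fun t _ => mem_iUnion.2 ⟨t, htU t⟩)
  refine ⟨δ, hδ, fun p q hpq hq hd => ?_⟩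
  obtain ⟨c, hc⟩ := h p ⟨zero_le, hpq.le.trans hq⟩
  have hmem : ∀ s, p ≤ s → s ≤ q → s ∈ U c := fun s hs1 hs2 => by
    refine hc (Metric.mem_ball.2 (lt_of_le_of_lt ?_ hd))
    rw [NNReal.dist_eq, NNReal.dist_eq, abs_of_nonneg (sub_nonneg.2 (NNReal.coe_le_coe.2 hs1)),
      abs_of_nonneg (sub_nonneg.2 (NNReal.coe_le_coe.2 hpq.le))]
    exact sub_le_sub_right (NNReal.coe_le_coe.2 hs2) _
  rcases le_or_gt c p with hcp | hcp
  · have hall : ∀ s, p ≤ s → s ≤ q → x s = x c := fun s h1 h2 =>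
      hr c s (hmem s h1 h2) (hcp.trans h1)
    exact ⟨q, hpq, le_rfl, fun s h1 h2 => (hall s h1 h2.le).trans (hall p le_rfl hpq.le).symm,
      fun s h1 h2 => congrArg x (le_antisymm h2 h1)⟩
  rcases le_or_gt c q with hcq | hcq
  · exact ⟨c, hcp, hcq, fun s h1 h2 => (ha c s (hmem s h1 (h2.le.trans hcq)) h2).trans
        (ha c p (hmem p le_rfl hpq.le) hcp).symm,
      fun s h1 h2 => (hr c s (hmem s (hcp.le.trans h1) h2) h1).trans
        (hr c q (hmem q hpq.le le_rfl) hcq).symm⟩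
  · have hall : ∀ s, p ≤ s → s ≤ q → x s = a c := fun s h1 h2 =>
      ha c s (hmem s h1 h2) (h2.trans_lt hcq)
    exact ⟨q, hpq, le_rfl, fun s h1 h2 => (hall s h1 h2.le).trans (hall p le_rfl hpq.le).symm,
      fun s h1 h2 => congrArg x (le_antisymm h2 h1)⟩

lemma IsRegularPath.exists_bound (hx : IsRegularPath x) (T : ℝ≥0) : ∃ N, ∀ t ≤ T, x t ≤ N := by
  have := (isCompact_Icc (a := (0 : ℝ≥0)) (b := T)).induction_on
    (p := fun s => ∃ N, ∀ t ∈ s, x t ≤ N) ⟨0, by simp⟩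
    (fun s t hst ⟨N, hN⟩ => ⟨N, fun u hu => hN u (hst hu)⟩)
    (fun s t ⟨N, hN⟩ ⟨M, hM⟩ => ⟨max N M, fun u hu => hu.elim
      (fun h => (hN u h).trans (le_max_left _ _)) fun h => (hM u h).trans (le_max_right _ _)⟩)
    (fun t _ => by
      obtain ⟨U, hU, htU, hr, a, ha⟩ := hx.exists_open t
      refine ⟨U, mem_nhdsWithin_of_mem_nhds (hU.mem_nhds htU), max (x t) a, fun s hs => ?_⟩
      rcases le_or_gt t s with h | h
      · exact (hr s hs h).le.trans (le_max_left _ _)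
      · exact (ha s hs h).le.trans (le_max_right _ _))
  obtain ⟨N, hN⟩ := this
  exact ⟨N, fun t ht => hN t ⟨zero_le, ht⟩⟩

/-- The times in `(a, b]` at which the path jumps by `m - 1`. -/
def crossingSet (m : ℕ) (x : ℝ≥0 → ℕ) (a b : ℝ≥0) : Set ℝ≥0 :=
  {s | a < s ∧ s ≤ b ∧ ∀ᶠ r in 𝓝[<] s, x s + 1 = x r + m}

lemma exists_mem_of_eventually_lt {p : ℝ≥0 → Prop} {a s : ℝ≥0} (has : a < s)
    (h : ∀ᶠ r in 𝓝[<] s, p r) : ∃ r, a < r ∧ r < s ∧ p r := by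
  have : (𝓝[<] s).NeBot := nhdsLT_neBot_of_exists_lt ⟨a, has⟩
  obtain ⟨r, hr, h1, h2⟩ := (h.and (Ioo_mem_nhdsLT has)).exists
  exact ⟨r, h1, h2, hr⟩

/-- As m > 1, staying constant is not a crossing, so only the jump time can count, and the jump
there is the increment over the interval. -/
lemma SingleJump.encard_crossingSet {a b : ℝ≥0} (h : SingleJump x a b) (hm : 1 < m) :
    (crossingSet m x a b).encard = ((if x b + 1 = x a + m then 1 else 0 : ℕ) : ℕ∞) := by
  obtain ⟨t, hat, htb, hl, hr⟩ := h
  have hmem : ∀ s ∈ crossingSet m x a b, s = t ∧ x b + 1 = x a + m := by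
    rintro s ⟨h1, h2, h3⟩
    rcases lt_trichotomy s t with hst | rfl | hst
    · obtain ⟨r, har, hrs, hr'⟩ := exists_mem_of_eventually_lt h1 h3
      rw [hl s h1.le hst, hl r har.le (hrs.trans hst)] at hr'
      omega
    · obtain ⟨r, har, hrs, hr'⟩ := exists_mem_of_eventually_lt h1 h3
      rw [hr s le_rfl h2, hl r har.le hrs] at hr'
      exact ⟨rfl, hr'⟩
    · obtain ⟨r, har, hrs, hr'⟩ := exists_mem_of_eventually_lt hst h3
      rw [hr s hst.le h2, hr r har.le (hrs.le.trans h2)] at hr'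
      omega
  split_ifs with hx
  · have : crossingSet m x a b = {t} := by
      refine Subset.antisymm (fun s hs => (hmem s hs).1) ?_
      rintro _ rfl
      refine ⟨hat, htb, ?_⟩
      filter_upwards [Ioo_mem_nhdsLT hat] with r hr'
      rw [hr _ le_rfl htb, hl r hr'.1.le hr'.2, hx]
    rw [this, encard_singleton, Nat.cast_one]
  · have : crossingSet m x a b = ∅ := eq_empty_of_forall_notMem fun s hs => hx (hmem s hs).2
    rw [this, encard_empty, Nat.cast_zero]

/-- The number of increments `m - 1` of the path along the first `n` steps of the grid with
mesh `h`. -/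
def gridCount (m : ℕ) (a : ℕ → ℕ) (n : ℕ) : ℕ :=
  ∑ l ∈ Finset.range n, if a (l + 1) + 1 = a l + m then 1 else 0

lemma encard_crossingSet_grid (hm : 1 < m) (h : ℝ≥0) (n : ℕ)
    (hs : ∀ l < n, SingleJump x (l * h) ((l + 1 : ℕ) * h)) :
    (crossingSet m x 0 (n * h)).encard = gridCount m (fun l => x (l * h)) n := by
  induction n with
  | zero =>
    have : crossingSet m x 0 ((0 : ℕ) * h) = ∅ :=
      eq_empty_of_forall_notMem fun s hs => by
        have h1 := hs.1.trans_le hs.2.1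
        simp at h1
    rw [this, encard_empty]
    simp [gridCount]
  | succ n ih =>
    have hle : (n : ℝ≥0) * h ≤ ((n + 1 : ℕ) : ℝ≥0) * h := by gcongr; omega
    have hun : crossingSet m x 0 ((n + 1 : ℕ) * h) =
        crossingSet m x 0 (n * h) ∪ crossingSet m x (n * h) ((n + 1 : ℕ) * h) := by
      ext s
      constructor
      · rintro ⟨h1, h2, h3⟩
        rcases le_or_gt s (n * h) with h4 | h4
        · exact Or.inl ⟨h1, h4, h3⟩
        · exact Or.inr ⟨h4, h2, h3⟩
      · rintro (⟨h1, h2, h3⟩ | ⟨h1, h2, h3⟩)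
        · exact ⟨h1, h2.trans hle, h3⟩
        · exact ⟨zero_le.trans_lt h1, h2, h3⟩
    have hd : Disjoint (crossingSet m x 0 (n * h))
        (crossingSet m x (n * h) ((n + 1 : ℕ) * h)) :=
      Set.disjoint_left.2 fun s h1 h2 => h1.2.1.not_gt h2.1
    rw [hun, encard_union_eq hd, ih fun l hl => hs l (by omega),
      (hs n (by omega)).encard_crossingSet hm, gridCount, gridCount, Finset.sum_range_succ]
    exact (Nat.cast_add _ _).symm

/-- Along fine grids the crossings are counted exactly. -/
lemma IsRegularPath.eventually_encard_crossingSet (hx : IsRegularPath x) (hm : 1 < m) {T : ℝ≥0}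
    (hT : 0 < T) : ∀ᶠ n : ℕ in atTop, (crossingSet m x 0 T).encard =
      gridCount m (fun l => x (l * (T / (n + 1 : ℕ)))) (n + 1) := by
  obtain ⟨δ, hδ, h⟩ := hx.exists_singleJump T
  have hlim : Tendsto (fun n : ℕ => (T : ℝ) / ((n + 1 : ℕ) : ℝ)) atTop (𝓝 0) :=
    (tendsto_const_div_atTop_nhds_zero_nat (T : ℝ)).comp (tendsto_add_atTop_nat 1)
  filter_upwards [hlim.eventually (gt_mem_nhds hδ)] with n hn
  have hn0 : ((n + 1 : ℕ) : ℝ≥0) ≠ 0 := by positivity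
  have hpos : 0 < T / (n + 1 : ℕ) := by positivity
  rw [← encard_crossingSet_grid hm]
  · rw [mul_div_cancel₀ T hn0]
  · intro l hl
    refine h _ _ ?_ ?_ ?_
    · gcongr; omega
    · calc ((l + 1 : ℕ) : ℝ≥0) * (T / (n + 1 : ℕ)) ≤ (n + 1 : ℕ) * (T / (n + 1 : ℕ)) := by
            gcongr
            omega
        _ = T := mul_div_cancel₀ T hn0
    · rw [NNReal.dist_eq]
      push_cast at hn ⊢
      rw [show ((l : ℝ) + 1) * (T / (n + 1)) - l * (T / (n + 1)) = T / (n + 1) by ring,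
        abs_of_nonneg (by positivity)]
      exact hn

lemma IsRegularPath.finite_crossingSet (hx : IsRegularPath x) (hm : 1 < m) {T : ℝ≥0}
    (hT : 0 < T) : (crossingSet m x 0 T).Finite := by
  obtain ⟨n, hn⟩ := (hx.eventually_encard_crossingSet hm hT).exists
  rw [← encard_ne_top_iff, hn]
  exact ENat.natCast_ne_top _

lemma extinctionTime_lt_top : extinctionTime x < ∞ ↔ ∃ t, x t = 0 := by
  simp [extinctionTime, iInf_lt_iff]

/-- If the path is absorbed at `0` and has reached it at time `T`, then the crossings until
extinction are those up to time `T`. -/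
lemma crossingNumber_extinctionTime (h0 : ∀ s t, s ≤ t → x s = 0 → x t = 0) (hm : 1 < m) {T : ℝ≥0}
    (hT : x T = 0) :
    crossingNumber m x (extinctionTime x) = (crossingSet m x 0 T).encard := by
  have hle : extinctionTime x ≤ T := iInf₂_le T hT
  unfold crossingNumber crossingSet
  congr 1
  ext s
  simp only [mem_ofPred_eq]
  refine and_congr_right fun hs => and_congr_left fun h3 => ?_
  refine ⟨fun h => ENNReal.coe_le_coe.1 (h.trans hle), fun _ => ?_⟩
  -- A crossing after a zero of the path would be a step from 0 to 0, impossible for m ≠ 1.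
  refine le_iInf₂ fun t ht => ENNReal.coe_le_coe.2 ?_
  by_contra! hts
  obtain ⟨r, h1, h2, h4⟩ := exists_mem_of_eventually_lt hts h3
  rw [h0 t s hts.le ht, h0 t r h1.le ht] at h4
  omega

/-- Right-continuity in a discrete space repeats each value at a later rational time, arbitrarily
close; so countably many conditions suffice. -/
lemma IsRegularPath.absorbed (hx : IsRegularPath x)
    (h : ∀ p q : ℚ, p ≤ q → x (p : ℝ).toNNReal = 0 → x (q : ℝ).toNNReal = 0) (s t : ℝ≥0)
    (hst : s ≤ t) (hs : x s = 0) : x t = 0 := by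
  have hrat : ∀ u v : ℝ≥0, u < v → ∃ q : ℚ, u < (q : ℝ).toNNReal ∧ (q : ℝ).toNNReal < v ∧
      x (q : ℝ).toNNReal = x u := by
    intro u v huv
    have : (𝓝[>] u).NeBot := nhdsGT_neBot_of_exists_gt ⟨v, huv⟩
    obtain ⟨w, huw, hw⟩ := (mem_nhdsGE_iff_exists_Ico_subset' huv).1 (hx.eventually_right u)
    obtain ⟨q, _, h1, h2⟩ := (NNReal.lt_iff_exists_rat_btwn u (min v w)).1 (lt_min huv huw)
    exact ⟨q, h1, h2.trans_le (min_le_left _ _), hw ⟨h1.le, h2.trans_le (min_le_right _ _)⟩⟩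
  rcases hst.eq_or_lt with rfl | hlt
  · exact hs
  obtain ⟨p, hp1, hp2, hp⟩ := hrat s t hlt
  obtain ⟨q, hq1, hq2, hq⟩ := hrat t (t + 1) (lt_add_one t)
  rw [← hq]
  refine h p q ?_ (hp.trans hs)
  have h1 := hp2.trans hq1
  exact_mod_cast (Real.toNNReal_lt_toNNReal_iff'.1 h1).1.le

end Path

/-! ### Transition functions: generator, absorption, transience -/

section Transition

/-- A version of Scheffé's lemma: if sequences with sum zero which are nonnegative off a fixed index
converge pointwise to such a sequence, they converge against bounded functions. -/
lemma tendsto_tsum_mul_of_hasSum_zero {a : ℕ → ℕ → ℝ} {q : ℕ → ℝ} (ha : ∀ n, HasSum (a n) 0)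
    (hq : HasSum q 0) (i : ℕ) (hpos : ∀ n j, j ≠ i → 0 ≤ a n j)
    (hlim : ∀ j, Tendsto (fun n => a n j) atTop (𝓝 (q j))) {g : ℕ → ℝ} (hg : ∀ j, |g j| ≤ 1) :
    Tendsto (fun n => ∑' j, a n j * g j) atTop (𝓝 (∑' j, q j * g j)) := by
  have hqpos : ∀ j, j ≠ i → 0 ≤ q j := fun j hj =>
    ge_of_tendsto' (hlim j) fun n => hpos n j hj
  have hsub : ∀ n, HasSum (fun j => a n j - q j) 0 := fun n => by
    simpa using (ha n).sub hq
  have hdom : Tendsto (fun n => ∑' j, max (q j - a n j) 0) atTop (𝓝 (∑' _ : ℕ, (0 : ℝ))) := by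
    refine tendsto_tsum_of_dominated_convergence
      (bound := fun j => |q j| + if j = i then 1 else 0)
      (hq.summable.abs.add (hasSum_ite_eq i (1 : ℝ)).summable) (fun j => ?_) ?_
    · have h := ((hlim j).const_sub (q j)).max (tendsto_const_nhds (x := (0 : ℝ)))
      rwa [sub_self, max_self] at h
    · filter_upwards [((hlim i).const_sub (q i)).eventually
        (gt_mem_nhds (show q i - q i < 1 by simp))] with n hn j
      rw [Real.norm_of_nonneg (le_max_right _ _)]
      refine max_le ?_ (by positivity)
      split_ifs with hj
      · subst hj
        linarith [abs_nonneg (q j)]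
      · linarith [hpos n j hj, le_abs_self (q j)]
  rw [tsum_zero] at hdom
  -- Since |x| = x + 2 max(-x, 0) and the differences sum to zero, the total variation is twice the
  -- sum of the negative parts.
  have habs : Tendsto (fun n => ∑' j, |a n j - q j|) atTop (𝓝 0) := by
    have h2 := hdom.const_mul 2
    rw [mul_zero] at h2
    refine h2.congr fun n => ?_
    have hmax : Summable fun j => max (q j - a n j) 0 := by
      refine Summable.of_nonneg_of_le (fun _ => le_max_right _ _) (fun j => ?_)
        (hsub n).summable.abs
      exact max_le (by rw [abs_sub_comm]; exact le_abs_self _) (abs_nonneg _)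
    have h3 := (hsub n).add (hmax.hasSum.mul_left 2)
    rw [zero_add] at h3
    rw [← h3.tsum_eq]
    refine tsum_congr fun j => ?_
    rcases le_total (q j) (a n j) with h | h
    · rw [max_eq_right (by linarith), abs_of_nonneg (by linarith)]; ring
    · rw [max_eq_left (by linarith), abs_of_nonpos (by linarith)]; ring
  have hmul : ∀ {f : ℕ → ℝ}, Summable f → Summable fun j => f j * g j := fun hf =>
    Summable.of_norm_bounded hf.norm fun j => by
      rw [norm_mul]; exact mul_le_of_le_one_right (norm_nonneg _) (hg j)
  rw [tendsto_iff_norm_sub_tendsto_zero]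
  refine squeeze_zero (fun _ => norm_nonneg _) (fun n => ?_) habs
  rw [← (hmul (ha n).summable).tsum_sub (hmul hq.summable)]
  have hs := (hmul (hsub n).summable)
  simp only [← sub_mul]
  refine (norm_tsum_le_tsum_norm hs.norm).trans ?_
  refine hs.norm.tsum_le_tsum (fun j => ?_) (hsub n).summable.abs
  rw [norm_mul]
  exact mul_le_of_le_one_right (norm_nonneg _) (hg j)

variable {w b : ℕ → ℝ} {p : ℝ≥0 → ℕ → ℕ → ℝ}

lemma hasSum_qMatrix_mul {f : ℕ → ℝ} {i : ℕ} (hi : 1 ≤ i) {a : ℝ}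
    (h : HasSum (fun k => b k * f (k + (i - 1))) a) :
    HasSum (fun j => qMatrix w b i j * f j) (w i * a) := by
  rw [← hasSum_nat_add_iff' (i - 1)]
  have h0 : ∑ j ∈ Finset.range (i - 1), qMatrix w b i j * f j = 0 :=
    Finset.sum_eq_zero fun j hj => by
      rw [Finset.mem_range] at hj
      rw [qMatrix, if_neg (by omega), zero_mul]
  rw [h0, sub_zero]
  refine hasSum_of_eq (fun k => ?_) (h.mul_left (w i))
  rw [qMatrix, if_pos (by omega), show k + (i - 1) + 1 - i = k by omega, mul_assoc]

lemma qMatrix_zero_left (w b : ℕ → ℝ) (j : ℕ) : qMatrix w b 0 j = 0 := if_neg (by simp)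

lemma hasSum_qMatrix (hb : IsBranchingRate b) (i : ℕ) : HasSum (qMatrix w b i) 0 := by
  rcases Nat.eq_zero_or_pos i with rfl | hi
  · exact hasSum_of_eq (qMatrix_zero_left w b) hasSum_zero
  · have h := hasSum_qMatrix_mul (w := w) (f := fun _ => 1) hi (by simpa using hb.hasSum_zero)
    simpa using h

lemma IsTransitionFunction.le_one (hp : IsTransitionFunction p) (t : ℝ≥0) (i j : ℕ) :
    p t i j ≤ 1 :=
  le_hasSum (hp.hasSum_one t i) j fun k _ => hp.nonneg t i k

lemma IsTransitionFunction.mul_le (hp : IsTransitionFunction p) (s t : ℝ≥0) (i k j : ℕ) :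
    p s i k * p t k j ≤ p (s + t) i j :=
  le_hasSum (hp.chapman_kolmogorov s t i j) k
    fun k _ => mul_nonneg (hp.nonneg s i k) (hp.nonneg t k j)

lemma IsWMBTransitionFunction.tendsto_slope (hp : IsWMBTransitionFunction w b p) (i j : ℕ)
    {T : ℝ≥0} (hT : 0 < T) :
    Tendsto (fun n : ℕ => (p (T / (n + 1 : ℕ)) i j - if i = j then 1 else 0) /
      ((T / (n + 1 : ℕ) : ℝ≥0) : ℝ)) atTop (𝓝 (qMatrix w b i j)) := by
  have h := hasDerivWithinAt_iff_tendsto_slope.1 (hp.deriv_zero i j)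
  have hlim : Tendsto (fun n : ℕ => (T : ℝ) / ((n + 1 : ℕ) : ℝ)) atTop (𝓝[Ici 0 \ {0}] 0) := by
    refine tendsto_nhdsWithin_iff.2 ⟨(tendsto_const_div_atTop_nhds_zero_nat (T : ℝ)).comp
      (tendsto_add_atTop_nat 1), Eventually.of_forall fun n => ?_⟩
    have : 0 < (T : ℝ) / ((n + 1 : ℕ) : ℝ) := by positivity
    exact ⟨this.le, this.ne'⟩
  refine (h.comp hlim).congr fun n => ?_
  have e : ((T : ℝ) / ((n + 1 : ℕ) : ℝ)) = ((T / (n + 1 : ℕ) : ℝ≥0) : ℝ) := by push_cast; rfl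
  simp only [Function.comp_apply, slope_def_field]
  rw [e, Real.toNNReal_coe, Real.toNNReal_zero, hp.zero, sub_zero]

/-- With n steps, p_00(t) ≥ p_00(t/n)^n ≥ 1 + n (p_00(t/n) - 1) by Bernoulli, and the right side
tends to 1 + t q_00 = 1. -/
lemma IsWMBTransitionFunction.zero_zero (hp : IsWMBTransitionFunction w b p) (t : ℝ≥0) :
    p t 0 0 = 1 := by
  rcases eq_or_ne t 0 with rfl | ht
  · rw [hp.zero, if_pos rfl]
  refine le_antisymm (hp.le_one t 0 0) ?_
  have ht0 : 0 < t := pos_iff_ne_zero.2 ht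
  have h := (hp.tendsto_slope 0 0 ht0).mul_const (t : ℝ)
  rw [qMatrix_zero_left, zero_mul] at h
  have hpow : ∀ (s : ℝ≥0) (n : ℕ), p s 0 0 ^ n ≤ p (n * s) 0 0 := by
    intro s n
    induction n with
    | zero => simp [hp.zero]
    | succ n ih =>
      rw [pow_succ, Nat.cast_succ, add_mul, one_mul]
      exact (mul_le_mul_of_nonneg_right ih (hp.nonneg s 0 0)).trans (hp.mul_le _ _ _ _ _)
  have hle : ∀ n : ℕ, (p (t / (n + 1 : ℕ)) 0 0 - if 0 = 0 then 1 else 0) /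
      ((t / (n + 1 : ℕ) : ℝ≥0) : ℝ) * t ≤ p t 0 0 - 1 := by
    intro n
    have h1 := hpow (t / (n + 1 : ℕ)) (n + 1)
    rw [mul_div_cancel₀ t (by positivity)] at h1
    have h2 := one_add_mul_le_pow
      (show -2 ≤ p (t / (n + 1 : ℕ)) 0 0 - 1 by linarith [hp.nonneg (t / (n + 1 : ℕ)) 0 0]) (n + 1)
    rw [add_sub_cancel] at h2
    have htR : (t : ℝ) ≠ 0 := by exact_mod_cast ht
    rw [if_pos rfl]
    rw [NNReal.coe_div, NNReal.coe_natCast, div_div_eq_mul_div, div_mul_cancel₀ _ htR]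
    linarith
  linarith [le_of_tendsto' h hle]

/-- The chain can descend one unit at a time, because q_(j+1,j) = w_(j+1) b_0 > 0. -/
lemma IsWMBTransitionFunction.exists_pos (hp : IsWMBTransitionFunction w b p)
    (hw : ∀ i, 1 ≤ i → 0 < w i) (hb0 : 0 < b 0) (j : ℕ) : ∃ s, 0 < p s j 0 := by
  induction j with
  | zero => exact ⟨0, by simp [hp.zero]⟩
  | succ j ih =>
    obtain ⟨s, hs⟩ := ih
    have h := hp.tendsto_slope (j + 1) j one_pos
    have hq : 0 < qMatrix w b (j + 1) j := by
      rw [qMatrix, if_pos (by omega), Nat.sub_self]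
      exact mul_pos (hw _ (by omega)) hb0
    obtain ⟨n, hn⟩ := (h.eventually (lt_mem_nhds hq)).exists
    rw [if_neg (by omega), sub_zero] at hn
    have hpos : 0 < p (1 / (n + 1 : ℕ)) (j + 1) j :=
      (div_pos_iff_of_pos_right (by positivity)).1 hn
    exact ⟨1 / (n + 1 : ℕ) + s, (mul_pos hpos hs).trans_le (hp.mul_le _ _ _ _ _)⟩

/-- The states `j ≥ 1` are transient. -/
lemma IsWMBTransitionFunction.tendsto_zero (hp : IsWMBTransitionFunction w b p)
    (hw : ∀ i, 1 ≤ i → 0 < w i) (hb0 : 0 < b 0) (i : ℕ) {j : ℕ} (hj : 1 ≤ j) :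
    Tendsto (fun t => p t i j) atTop (𝓝 0) := by
  obtain ⟨s, hs⟩ := hp.exists_pos hw hb0 j
  -- As 0 is absorbing, p_i0 is increasing and bounded; its increment over a step s dominates
  -- p_ij(t) p_j0(s) and tends to 0.
  have hstep : ∀ t u, p t i 0 + p t i j * p u j 0 ≤ p (t + u) i 0 := by
    intro t u
    have h := sum_le_hasSum {0, j} (fun k _ => mul_nonneg (hp.nonneg t i k) (hp.nonneg u k 0))
      (hp.chapman_kolmogorov t u i 0)
    rwa [Finset.sum_pair (by omega), hp.zero_zero, mul_one] at h
  have hmono : Monotone fun t => p t i 0 := by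
    intro t u htu
    have h := hstep t (u - t)
    rw [add_tsub_cancel_of_le htu] at h
    exact (le_add_of_nonneg_right (mul_nonneg (hp.nonneg _ _ _) (hp.nonneg _ _ _))).trans h
  have hlim := tendsto_atTop_ciSup hmono ⟨1, by rintro _ ⟨t, rfl⟩; exact hp.le_one t i 0⟩
  have hlim' := hlim.comp (tendsto_atTop_mono (fun t => le_self_add) tendsto_id (f := fun t : ℝ≥0 => t)
    (g := fun t => t + s))
  have hdiff := (hlim'.sub hlim).div_const (p s j 0)
  rw [sub_self, zero_div] at hdiff
  refine squeeze_zero (fun t => hp.nonneg t i j) (fun t => ?_) hdiff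
  rw [le_div_iff₀ hs]
  have := hstep t s
  simp only [Function.comp_apply]
  linarith

/-- `v` marks the jumps of size `m - 1` in the transition from `i` to `j`. -/
noncomputable def markedPow (m : ℕ) (v u : ℝ) (i j : ℕ) : ℝ :=
  (if j + 1 = i + m then v else 1) * u ^ j

lemma markedPow_mem {m : ℕ} {v u : ℝ} (hv : v ∈ Icc (0 : ℝ) 1) (hu : u ∈ Icc (0 : ℝ) 1)
    (i j : ℕ) : markedPow m v u i j ∈ Icc (0 : ℝ) 1 := by
  have h1 : (if j + 1 = i + m then v else 1) ∈ Icc (0 : ℝ) 1 := by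
    split_ifs
    exacts [hv, ⟨zero_le_one, le_rfl⟩]
  exact ⟨mul_nonneg h1.1 (pow_nonneg hu.1 j),
    mul_le_one₀ h1.2 (pow_nonneg hu.1 j) (pow_le_one₀ hu.1 hu.2)⟩

/-- After the shift k = j - i + 1 the row factors as w_i u^(i-1) times the equation for u. -/
lemma hasSum_qMatrix_markedPow {m : ℕ} {v u : ℝ}
    (h : HasSum (fun k => (if k = m then v else 1) * (b k * u ^ k)) 0) (i : ℕ) :
    HasSum (fun j => qMatrix w b i j * markedPow m v u i j) 0 := by
  rcases Nat.eq_zero_or_pos i with rfl | hi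
  · exact hasSum_of_eq (fun j => by rw [qMatrix_zero_left, zero_mul]) hasSum_zero
  · have h1 := h.mul_right (u ^ (i - 1))
    rw [zero_mul] at h1
    have h2 := hasSum_qMatrix_mul (w := w) (b := b) (f := markedPow m v u i) hi
      (hasSum_of_eq (fun k => ?_) h1)
    · simpa using h2
    · have e : k + (i - 1) + 1 = i + m ↔ k = m := by omega
      simp only [markedPow, e, pow_add]
      ring

/-- The derivative at time 0 of the marked mean is the generator sum, which vanishes; hence the
one-step defect on a grid of n + 1 steps is o(1/n). The Scheffé lemma moves the limit inside the sum
over j. -/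
lemma IsWMBTransitionFunction.tendsto_generator (hp : IsWMBTransitionFunction w b p)
    (hb : IsBranchingRate b) {m : ℕ} (hm : 1 < m) {v u : ℝ} (hv : v ∈ Icc (0 : ℝ) 1)
    (hu : u ∈ Icc (0 : ℝ) 1)
    (h : HasSum (fun k => (if k = m then v else 1) * (b k * u ^ k)) 0) (i : ℕ)
    {T : ℝ≥0} (hT : 0 < T) :
    Tendsto (fun n : ℕ => ((n + 1 : ℕ) : ℝ) *
      |(∑' j, p (T / (n + 1 : ℕ)) i j * markedPow m v u i j) - u ^ i|) atTop (𝓝 0) := by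
  have hg : ∀ j, |markedPow m v u i j| ≤ 1 := fun j => by
    rw [abs_of_nonneg (markedPow_mem hv hu i j).1]
    exact (markedPow_mem hv hu i j).2
  have hδ : HasSum (fun j => if i = j then (1 : ℝ) else 0) 1 := by
    simpa only [eq_comm] using hasSum_ite_eq i (1 : ℝ)
  have hsum0 : ∀ n : ℕ, HasSum (fun j => (p (T / (n + 1 : ℕ)) i j - if i = j then 1 else 0) /
      ((T / (n + 1 : ℕ) : ℝ≥0) : ℝ)) 0 := fun n => by
    have h0 := ((hp.hasSum_one (T / (n + 1 : ℕ)) i).sub hδ).div_const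
      ((T / (n + 1 : ℕ) : ℝ≥0) : ℝ)
    rwa [sub_self, zero_div] at h0
  have hlim := tendsto_tsum_mul_of_hasSum_zero
    (a := fun (n : ℕ) j => (p (T / (n + 1 : ℕ)) i j - if i = j then 1 else 0) /
      ((T / (n + 1 : ℕ) : ℝ≥0) : ℝ))
    hsum0
    (hasSum_qMatrix (w := w) hb i) i
    (fun n j hj => by
      rw [if_neg hj.symm, sub_zero]
      exact div_nonneg (hp.nonneg _ _ _) (NNReal.coe_nonneg _))
    (fun j => hp.tendsto_slope i j hT) hg
  rw [(hasSum_qMatrix_markedPow h i).tsum_eq] at hlim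
  have hlim' := (hlim.abs).const_mul (T : ℝ)
  rw [abs_zero, mul_zero] at hlim'
  refine hlim'.congr fun n => ?_
  have hs1 : Summable fun j => p (T / (n + 1 : ℕ)) i j * markedPow m v u i j :=
    Summable.of_norm_bounded (hp.hasSum_one (T / (n + 1 : ℕ)) i).summable.norm fun j => by
      rw [norm_mul]; exact mul_le_of_le_one_right (norm_nonneg _) (hg j)
  have hs2 : HasSum (fun j => (if i = j then (1 : ℝ) else 0) * markedPow m v u i j) (u ^ i) := by
    refine hasSum_of_eq (fun j => ?_) (hasSum_ite_eq i (u ^ i))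
    by_cases hij : i = j
    · subst hij
      rw [markedPow, if_neg (show ¬ (i + 1 = i + m) by omega)]
      simp
    · simp [hij, Ne.symm hij]
  have hs3 := (hs1.hasSum.sub hs2).div_const ((T / (n + 1 : ℕ) : ℝ≥0) : ℝ)
  have hTR : (0 : ℝ) < T := by exact_mod_cast hT
  have e : ∑' j, (p (T / (n + 1 : ℕ)) i j - if i = j then 1 else 0) /
      ((T / (n + 1 : ℕ) : ℝ≥0) : ℝ) * markedPow m v u i j = _ :=
    (hasSum_of_eq (fun j => by ring) hs3).tsum_eq
  rw [e, abs_div, abs_of_nonneg (NNReal.coe_nonneg _)]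
  push_cast
  field_simp

end Transition

/-! ### Uniqueness of coefficients; Markov chains on a time grid -/

section Grid

/-- Two power series which are absolutely summable at `1` and agree on `(0, 1)` are equal. -/
lemma eq_of_tsum_mul_pow_eq {p r : ℕ → ℝ} (hp : Summable p) (hr : Summable r)
    (h : ∀ v, 0 < v → v < 1 → ∑' k, p k * v ^ k = ∑' k, r k * v ^ k) : p = r := by
  have hd : Summable fun k => p k - r k := hp.sub hr
  have hpow : ∀ {f : ℕ → ℝ}, Summable f → ∀ v : ℝ, 0 < v → v < 1 →
      Summable fun k => f k * v ^ k := fun hf v hv0 hv1 =>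
    Summable.of_norm_bounded hf.norm fun k => by
      rw [norm_mul, norm_pow, Real.norm_of_nonneg hv0.le]
      exact mul_le_of_le_one_right (norm_nonneg _) (pow_le_one₀ hv0.le hv1.le)
  have hzero : ∀ v : ℝ, 0 < v → v < 1 → ∑' k, (p k - r k) * v ^ k = 0 := fun v hv0 hv1 => by
    simp only [sub_mul]
    rw [(hpow hp v hv0 hv1).tsum_sub (hpow hr v hv0 hv1), h v hv0 hv1, sub_self]
  suffices H : ∀ k, p k - r k = 0 from funext fun k => sub_eq_zero.1 (H k)
  intro k
  induction k using Nat.strong_induction_on with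
  | _ k ih =>
    -- The earlier coefficients agree, so the difference can be divided by v^k; its continuity at 0
    -- then gives the k-th coefficient.
    have hdk : Summable fun l => p (l + k) - r (l + k) := (summable_nat_add_iff k).2 hd
    have hz : ∀ v : ℝ, 0 < v → v < 1 → ∑' l, (p (l + k) - r (l + k)) * v ^ l = 0 := by
      intro v hv0 hv1
      have h1 := (hpow hd v hv0 hv1).sum_add_tsum_nat_add k
      rw [hzero v hv0 hv1, Finset.sum_eq_zero fun l hl => by
        rw [ih l (Finset.mem_range.1 hl), zero_mul], zero_add] at h1
      simp only [pow_add, ← mul_assoc] at h1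
      rw [tsum_mul_right] at h1
      exact (mul_eq_zero.1 h1).resolve_right (pow_pos hv0 k).ne'
    have hc := (continuousOn_tsum_pow hdk.norm).continuousWithinAt
      (show (0 : ℝ) ∈ Icc (0 : ℝ) 1 by simp)
    have hc' := hc.mono_left (nhdsWithin_mono (0 : ℝ) (s := Ioo 0 1) Ioo_subset_Icc_self)
    have hne : (𝓝[Ioo (0 : ℝ) 1] 0).NeBot := by
      rw [nhdsWithin_Ioo_eq_nhdsGT zero_lt_one]; infer_instance
    have h0 : Tendsto (fun v : ℝ => ∑' l, (p (l + k) - r (l + k)) * v ^ l) (𝓝[Ioo (0 : ℝ) 1] 0)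
        (𝓝 0) := by
      refine tendsto_const_nhds.congr' ?_
      filter_upwards [self_mem_nhdsWithin] with v hv
      exact (hz v hv.1 hv.2).symm
    have h2 : ∑' l, (p (l + k) - r (l + k)) * (0 : ℝ) ^ l = 0 := tendsto_nhds_unique hc' h0
    rw [tsum_eq_single 0 fun l hl => by rw [zero_pow hl, mul_zero]] at h2
    simpa using h2

variable {Ω : Type*} [MeasurableSpace Ω] {μ : Measure Ω} [IsProbabilityMeasure μ]

lemma hasSum_measureReal_preimage {ι : Type*} [Countable ι] [MeasurableSpace ι]
    [MeasurableSingletonClass ι] (μ : Measure Ω) [IsFiniteMeasure μ] {H : Ω → ι}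
    (hH : Measurable H) : HasSum (fun y => μ.real (H ⁻¹' {y})) (μ.real univ) := by
  have h1 : ∑' y, μ (H ⁻¹' {y}) = μ univ := by
    rw [← measure_iUnion (fun y z hyz => Disjoint.preimage H (by simpa using hyz))
      (fun y => hH (measurableSet_singleton y)), ← preimage_iUnion, iUnion_of_singleton,
      preimage_univ]
  have h2 := ENNReal.hasSum_toReal (f := fun y => μ (H ⁻¹' {y}))
    (by rw [h1]; exact measure_ne_top _ _)
  rwa [← ENNReal.tsum_toReal_eq (fun y => measure_ne_top _ _), h1] at h2

/-- If `K` has conditional law `π y` given `H = y` and `F y` has small `π y`-integrals, then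
`F H K` has a small integral. -/
lemma abs_integral_le_of_kernel {ι : Type*} [Countable ι] [MeasurableSpace ι]
    [MeasurableSingletonClass ι] {H : Ω → ι} (hH : Measurable H) {K : Ω → ℕ} (hK : Measurable K)
    {π : ι → ℕ → ℝ} (hπ0 : ∀ y j, 0 ≤ π y j) (hπ : ∀ y, HasSum (π y) 1)
    (hker : ∀ y j, μ.real (H ⁻¹' {y} ∩ K ⁻¹' {j}) = μ.real (H ⁻¹' {y}) * π y j)
    {F : ι → ℕ → ℝ} (hF : ∀ y j, |F y j| ≤ 1) {η : ℝ} (hη : ∀ y, |∑' j, π y j * F y j| ≤ η) :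
    |∫ ω, F (H ω) (K ω) ∂μ| ≤ η := by
  have hHK : Measurable fun ω => (H ω, K ω) := hH.prodMk hK
  have hprob : IsProbabilityMeasure (μ.map fun ω => (H ω, K ω)) :=
    Measure.isProbabilityMeasure_map hHK.aemeasurable
  have hmeas : Measurable fun z : ι × ℕ => F z.1 z.2 := measurable_of_countable _
  have hint : Integrable (fun z : ι × ℕ => F z.1 z.2) (μ.map fun ω => (H ω, K ω)) :=
    Integrable.of_bound hmeas.aestronglyMeasurable 1
      (Eventually.of_forall fun z => hF z.1 z.2)
  have hreal : ∀ z : ι × ℕ, (μ.map fun ω => (H ω, K ω)).real {z} =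
      μ.real (H ⁻¹' {z.1}) * π z.1 z.2 := by
    rintro ⟨y, j⟩
    rw [map_measureReal_apply hHK (measurableSet_singleton _), ← hker]
    congr 1
    ext ω
    simp
  have hsumH := hasSum_measureReal_preimage μ hH
  rw [probReal_univ] at hsumH
  have hsummable : Summable fun z : ι × ℕ => μ.real (H ⁻¹' {z.1}) * π z.1 z.2 := by
    have h0 : (0 : ι × ℕ → ℝ) ≤ fun z => μ.real (H ⁻¹' {z.1}) * π z.1 z.2 := fun z =>
      mul_nonneg measureReal_nonneg (hπ0 z.1 z.2)
    have h1 : ∀ y, HasSum (fun j => μ.real (H ⁻¹' {y}) * π y j) (μ.real (H ⁻¹' {y})) := fun y => by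
      simpa only [mul_one] using (hπ y).mul_left (μ.real (H ⁻¹' {y}))
    have h2 : (fun y => ∑' j, μ.real (H ⁻¹' {y}) * π y j) = fun y => μ.real (H ⁻¹' {y}) :=
      funext fun y => (h1 y).tsum_eq
    rw [summable_prod_of_nonneg h0]
    exact ⟨fun y => (h1 y).summable, h2 ▸ hsumH.summable⟩
  have hsummableF : Summable fun z : ι × ℕ => μ.real (H ⁻¹' {z.1}) * π z.1 z.2 * F z.1 z.2 :=
    Summable.of_norm_bounded hsummable.norm fun z => by
      rw [norm_mul]; exact mul_le_of_le_one_right (norm_nonneg _) (hF _ _)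
  have e : ∫ ω, F (H ω) (K ω) ∂μ = ∑' y, μ.real (H ⁻¹' {y}) * ∑' j, π y j * F y j := by
    rw [← integral_map (φ := fun ω => (H ω, K ω)) (f := fun z : ι × ℕ => F z.1 z.2)
      hHK.aemeasurable hmeas.aestronglyMeasurable, integral_countable hint]
    simp only [hreal, smul_eq_mul]
    rw [hsummableF.tsum_prod]
    refine tsum_congr fun y => ?_
    rw [← tsum_mul_left]
    exact tsum_congr fun j => by ring
  have hb : ∀ y, ‖μ.real (H ⁻¹' {y}) * ∑' j, π y j * F y j‖ ≤ μ.real (H ⁻¹' {y}) * η := fun y => by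
    rw [norm_mul, Real.norm_of_nonneg measureReal_nonneg]
    exact mul_le_mul_of_nonneg_left (hη y) measureReal_nonneg
  rw [e, ← Real.norm_eq_abs]
  have := tsum_of_norm_bounded (hsumH.mul_right η) hb
  rwa [one_mul] at this

/-- The increments of W counted while G holds telescope to the value of W at the stopping index. -/
lemma exists_sum_ite_sub_eq (W : ℕ → ℝ) (G : ℕ → Prop) [DecidablePred G]
    (hG : ∀ k l, l ≤ k → G k → G l) (n : ℕ) :
    ∃ j, ∑ k ∈ Finset.range n, (if G k then W (k + 1) - W k else 0) = W j - W 0 ∧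
      ((∀ k < n, G k) → j = n) := by
  induction n with
  | zero => exact ⟨0, by simp⟩
  | succ n ih =>
    obtain ⟨j, hj, hjn⟩ := ih
    rw [Finset.sum_range_succ, hj]
    by_cases h : G n
    · refine ⟨n + 1, ?_, fun _ => rfl⟩
      rw [if_pos h, hjn fun k hk => hG n k hk.le h]
      ring
    · exact ⟨j, by rw [if_neg h, add_zero], fun h' => absurd (h' n (by omega)) h⟩

/-- The discounted value `v ^ (number of marked increments) * u ^ (current state)`. -/
noncomputable def gridValue (m : ℕ) (v u : ℝ) (a : ℕ → ℕ) (k : ℕ) : ℝ :=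
  v ^ gridCount m a k * u ^ a k

lemma gridValue_mem {m : ℕ} {v u : ℝ} (hv : v ∈ Icc (0 : ℝ) 1) (hu : u ∈ Icc (0 : ℝ) 1)
    (a : ℕ → ℕ) (k : ℕ) : gridValue m v u a k ∈ Icc (0 : ℝ) 1 :=
  ⟨mul_nonneg (pow_nonneg hv.1 _) (pow_nonneg hu.1 _),
    mul_le_one₀ (pow_le_one₀ hv.1 hv.2) (pow_nonneg hu.1 _) (pow_le_one₀ hu.1 hu.2)⟩

lemma gridCount_congr {m k : ℕ} {a c : ℕ → ℕ} (h : ∀ l ≤ k, a l = c l) :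
    gridCount m a k = gridCount m c k :=
  Finset.sum_congr rfl fun l hl => by
    rw [Finset.mem_range] at hl
    rw [h l (by omega), h (l + 1) (by omega)]

lemma gridValue_succ_sub (m : ℕ) (v u : ℝ) (a : ℕ → ℕ) (k : ℕ) :
    gridValue m v u a (k + 1) - gridValue m v u a k =
      v ^ gridCount m a k * (markedPow m v u (a k) (a (k + 1)) - u ^ a k) := by
  rw [gridValue, gridValue, gridCount, Finset.sum_range_succ, ← gridCount, markedPow]
  split_ifs
  · rw [pow_succ]; ring
  · rw [add_zero]; ring

lemma measurable_gridCount (m : ℕ) {A : ℕ → Ω → ℕ} (hA : ∀ l, Measurable (A l)) (k : ℕ) :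
    Measurable fun ω => gridCount m (fun l => A l ω) k := by
  refine Finset.measurable_sum _ fun l _ => Measurable.ite ?_ measurable_const measurable_const
  exact measurableSet_eq_fun ((hA (l + 1)).add_const 1) ((hA l).add_const m)

lemma measurable_gridValue (m : ℕ) (v u : ℝ) {A : ℕ → Ω → ℕ} (hA : ∀ l, Measurable (A l))
    (k : ℕ) : Measurable fun ω => gridValue m v u (fun l => A l ω) k :=
  ((measurable_of_countable fun n : ℕ => v ^ n).comp (measurable_gridCount m hA k)).mul
    ((measurable_of_countable fun n : ℕ => u ^ n).comp (hA k))

variable {A : ℕ → Ω → ℕ} {P : ℕ → ℕ → ℝ}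

/-- The prefix `y` of length `k + 1`, continued by `j`. -/
def extendPrefix {k : ℕ} (y : Fin (k + 1) → ℕ) (j l : ℕ) : ℕ :=
  if h : l < k + 1 then y ⟨l, h⟩ else j

/-- One step of a Markov chain on a grid, before it leaves `{0, …, N}`. -/
lemma abs_integral_step_le (hA : ∀ l, Measurable (A l)) (hP0 : ∀ i j, 0 ≤ P i j)
    (hP : ∀ i, HasSum (P i) 1)
    (hmarkov : ∀ (i : ℕ → ℕ) (n : ℕ), μ.real {ω | ∀ l ≤ n + 1, A l ω = i l} =
      μ.real {ω | ∀ l ≤ n, A l ω = i l} * P (i n) (i (n + 1)))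
    {m : ℕ} {v u : ℝ} (hv : v ∈ Icc (0 : ℝ) 1) (hu : u ∈ Icc (0 : ℝ) 1) (N : ℕ) {η : ℝ}
    (hη : 0 ≤ η) (h : ∀ i ≤ N, |(∑' j, P i j * markedPow m v u i j) - u ^ i| ≤ η) (k : ℕ) :
    |∫ ω, (if ∀ l ≤ k, A l ω ≤ N then gridValue m v u (fun l => A l ω) (k + 1) -
      gridValue m v u (fun l => A l ω) k else 0) ∂μ| ≤ η := by
  classical
  set H : Ω → Fin (k + 1) → ℕ := fun ω l => A l ω with hHdef
  have hH : Measurable H := measurable_pi_lambda _ fun l => hA l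
  -- The part of the increment known at time k: the mark collected so far, or 0 once the chain has
  -- left {0, …, N}.
  set c : (Fin (k + 1) → ℕ) → ℝ := fun y =>
    if ∀ l ≤ k, extendPrefix y 0 l ≤ N then v ^ gridCount m (extendPrefix y 0) k else 0 with hc
  have hc01 : ∀ y, c y ∈ Icc (0 : ℝ) 1 := fun y => by
    simp only [hc]
    split_ifs
    exacts [⟨pow_nonneg hv.1 _, pow_le_one₀ hv.1 hv.2⟩, ⟨le_rfl, zero_le_one⟩]
  have hext : ∀ ω, ∀ l ≤ k, extendPrefix (H ω) 0 l = A l ω := fun ω l hl => by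
    rw [extendPrefix, dif_pos (by omega)]
  set F : (Fin (k + 1) → ℕ) → ℕ → ℝ := fun y j =>
    c y * (markedPow m v u (y (Fin.last k)) j - u ^ y (Fin.last k)) with hF
  have e : ∀ ω, (if ∀ l ≤ k, A l ω ≤ N then gridValue m v u (fun l => A l ω) (k + 1) -
      gridValue m v u (fun l => A l ω) k else 0) = F (H ω) (A (k + 1) ω) := by
    intro ω
    have h1 : (∀ l ≤ k, extendPrefix (H ω) 0 l ≤ N) ↔ ∀ l ≤ k, A l ω ≤ N :=
      forall₂_congr fun l hl => by rw [hext ω l hl]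
    simp only [hF, hc, h1, gridCount_congr (hext ω), gridValue_succ_sub]
    split_ifs
    · rfl
    · rw [zero_mul]
  simp only [e]
  refine abs_integral_le_of_kernel hH (hA (k + 1)) (π := fun y => P (y (Fin.last k)))
    (fun y j => hP0 _ _) (fun y => hP _) (fun y j => ?_) (fun y j => ?_) (fun y => ?_)
  · have h1 := hmarkov (extendPrefix y j) k
    have e1 : {ω | ∀ l ≤ k, A l ω = extendPrefix y j l} = H ⁻¹' {y} := by
      ext ω
      simp only [mem_ofPred_eq, mem_preimage, mem_singleton_iff, funext_iff, hHdef]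
      constructor
      · intro h l
        rw [h l (by omega), extendPrefix, dif_pos l.2]
      · intro h l hl
        rw [extendPrefix, dif_pos (by omega), ← h]
    have e2 : {ω | ∀ l ≤ k + 1, A l ω = extendPrefix y j l} = H ⁻¹' {y} ∩ A (k + 1) ⁻¹' {j} := by
      rw [← e1]
      ext ω
      simp only [mem_ofPred_eq, mem_inter_iff, mem_preimage, mem_singleton_iff]
      have h3 : extendPrefix y j (k + 1) = j := by rw [extendPrefix, dif_neg (by omega)]
      constructor
      · intro h
        exact ⟨fun l hl => h l (by omega), (h (k + 1) le_rfl).trans h3⟩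
      · rintro ⟨h, h'⟩ l hl
        rcases Nat.lt_or_ge k l with hl' | hl'
        · obtain rfl : l = k + 1 := by omega
          rw [h', h3]
        · exact h l hl'
    rw [e1, e2] at h1
    rw [h1]
    simp [extendPrefix, Fin.last]
  · have h1 := markedPow_mem (m := m) hv hu (y (Fin.last k)) j
    have h2 : u ^ y (Fin.last k) ∈ Icc (0 : ℝ) 1 := ⟨pow_nonneg hu.1 _, pow_le_one₀ hu.1 hu.2⟩
    simp only [hF]
    rw [abs_mul, abs_of_nonneg (hc01 y).1]
    refine mul_le_one₀ (hc01 y).2 (abs_nonneg _) ?_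
    rw [abs_le]
    constructor <;> linarith [h1.1, h1.2, h2.1, h2.2]
  · have hs : Summable fun j => P (y (Fin.last k)) j * markedPow m v u (y (Fin.last k)) j :=
      Summable.of_norm_bounded (hP (y (Fin.last k))).summable.norm fun j => by
        rw [norm_mul, Real.norm_of_nonneg (markedPow_mem hv hu _ j).1]
        exact mul_le_of_le_one_right (norm_nonneg _) (markedPow_mem hv hu _ j).2
    have h1 := ((hs.hasSum.sub ((hP (y (Fin.last k))).mul_right (u ^ y (Fin.last k)))).mul_left
      (c y))
    have h2 : ∑' j, P (y (Fin.last k)) j * F y j = _ :=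
      (hasSum_of_eq (fun j => by simp only [hF]; ring) h1).tsum_eq
    rw [h2, one_mul, abs_mul, abs_of_nonneg (hc01 y).1]
    by_cases hy : ∀ l ≤ k, extendPrefix y 0 l ≤ N
    · have hyk : y (Fin.last k) ≤ N := by
        have := hy k le_rfl
        rwa [extendPrefix, dif_pos (by omega)] at this
      exact (mul_le_of_le_one_left (abs_nonneg _) (hc01 y).2).trans (h _ hyk)
    · simp only [hc, if_neg hy, zero_mul]
      exact hη

/-- A Markov chain on a grid whose one-step means of the discounted value change by `η` at most
inside `{0, …, N}`, and which stays there off `E`. -/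
lemma abs_integral_gridValue_sub_le (hA : ∀ l, Measurable (A l)) (hP0 : ∀ i j, 0 ≤ P i j)
    (hP : ∀ i, HasSum (P i) 1)
    (hmarkov : ∀ (i : ℕ → ℕ) (n : ℕ), μ.real {ω | ∀ l ≤ n + 1, A l ω = i l} =
      μ.real {ω | ∀ l ≤ n, A l ω = i l} * P (i n) (i (n + 1)))
    {m : ℕ} {v u : ℝ} (hv : v ∈ Icc (0 : ℝ) 1) (hu : u ∈ Icc (0 : ℝ) 1) (N : ℕ) {η : ℝ}
    (hη : 0 ≤ η) (h : ∀ i ≤ N, |(∑' j, P i j * markedPow m v u i j) - u ^ i| ≤ η) (n : ℕ)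
    {E : Set Ω} (hE : MeasurableSet E) (hEN : ∀ ω, ω ∉ E → ∀ l ≤ n, A l ω ≤ N) :
    |(∫ ω, gridValue m v u (fun l => A l ω) n ∂μ) -
      ∫ ω, gridValue m v u (fun l => A l ω) 0 ∂μ| ≤ n * η + μ.real E := by
  classical
  set W : ℕ → Ω → ℝ := fun k ω => gridValue m v u (fun l => A l ω) k with hW
  have hWm : ∀ k, Measurable (W k) := measurable_gridValue m v u hA
  have hW01 : ∀ k ω, W k ω ∈ Icc (0 : ℝ) 1 := fun k ω => gridValue_mem hv hu _ k
  have hWi : ∀ k, Integrable (W k) μ := fun k =>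
    Integrable.of_bound (hWm k).aestronglyMeasurable 1 (Eventually.of_forall fun ω => by
      rw [Real.norm_of_nonneg (hW01 k ω).1]; exact (hW01 k ω).2)
  set d : ℕ → Ω → ℝ := fun k ω => if ∀ l ≤ k, A l ω ≤ N then W (k + 1) ω - W k ω else 0 with hd
  have hGm : ∀ k, MeasurableSet {ω | ∀ l ≤ k, A l ω ≤ N} := fun k => by
    simp only [ofPred_forall]
    exact MeasurableSet.iInter fun l => MeasurableSet.iInter fun _ =>
      (hA l) (measurableSet_Iic (a := N))
  have hdi : ∀ k, Integrable (d k) μ := fun k => by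
    refine Integrable.of_bound (C := 1) (Measurable.ite (hGm k) ((hWm (k + 1)).sub (hWm k))
      measurable_const).aestronglyMeasurable (Eventually.of_forall fun ω => ?_)
    simp only [hd]
    split_ifs
    · rw [Real.norm_eq_abs, abs_le]
      constructor <;> linarith [(hW01 k ω).1, (hW01 k ω).2, (hW01 (k + 1) ω).1, (hW01 (k + 1) ω).2]
    · simp
  have hD : |∫ ω, ∑ k ∈ Finset.range n, d k ω ∂μ| ≤ n * η := by
    rw [integral_finsetSum _ fun k _ => hdi k]
    refine (Finset.abs_sum_le_sum_abs _ _).trans ?_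
    refine (Finset.sum_le_card_nsmul _ _ η fun k _ =>
      abs_integral_step_le hA hP0 hP hmarkov hv hu N hη h k).trans ?_
    simp
  -- Off E the stopped sum is the full increment; on E the error is a difference of two values in
  -- [0, 1].
  have hpt : ∀ ω, |W n ω - W 0 ω - ∑ k ∈ Finset.range n, d k ω| ≤ E.indicator 1 ω := by
    intro ω
    obtain ⟨j, hj, hjn⟩ := exists_sum_ite_sub_eq (fun k => W k ω) (fun k => ∀ l ≤ k, A l ω ≤ N)
      (fun k l hlk hk l' hl' => hk l' (hl'.trans hlk)) n
    simp only [hd]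
    rw [hj]
    by_cases hω : ω ∈ E
    · rw [indicator_of_mem hω, Pi.one_apply, abs_le]
      constructor <;> linarith [(hW01 n ω).1, (hW01 n ω).2, (hW01 j ω).1, (hW01 j ω).2]
    · rw [indicator_of_notMem hω, hjn fun k hk l hl => hEN ω hω l (by omega)]
      simp
  have hsumi : Integrable (fun ω => ∑ k ∈ Finset.range n, d k ω) μ :=
    integrable_finsetSum _ fun k _ => hdi k
  have hdiff : |∫ ω, (W n ω - W 0 ω - ∑ k ∈ Finset.range n, d k ω) ∂μ| ≤ μ.real E := by
    rw [← Real.norm_eq_abs, ← integral_indicator_one hE]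
    exact norm_integral_le_of_norm_le ((integrable_const (1 : ℝ)).indicator hE)
      (Eventually.of_forall hpt)
  have e : ∫ ω, (W n ω - W 0 ω - ∑ k ∈ Finset.range n, d k ω) ∂μ =
      ∫ ω, W n ω ∂μ - ∫ ω, W 0 ω ∂μ - ∫ ω, ∑ k ∈ Finset.range n, d k ω ∂μ := by
    rw [← integral_sub (hWi n) (hWi 0)]
    exact integral_sub ((hWi n).sub (hWi 0)) hsumi
  rw [e] at hdiff
  have h3 := abs_le.1 hdiff
  have h4 := abs_le.1 hD
  rw [abs_le]
  constructor <;> linarith [h3.1, h3.2, h4.1, h4.2]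

end Grid

/-! ### The continuous-time process and the martingale identity -/

section MarkovChain

variable {Ω : Type*} [MeasurableSpace Ω] {μ : Measure Ω} {w b : ℕ → ℝ}
  {p : ℝ≥0 → ℕ → ℕ → ℝ} {X : ℝ≥0 → Ω → ℕ}

/-- The Markov property of `X` with transition function `p`. -/
def IsMarkov (μ : Measure Ω) (p : ℝ≥0 → ℕ → ℕ → ℝ) (X : ℝ≥0 → Ω → ℕ) : Prop :=
  ∀ (t : ℕ → ℝ≥0), Monotone t → ∀ (i : ℕ → ℕ) (n : ℕ),
    μ.real {ω | ∀ l ≤ n + 1, X (t l) ω = i l} =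
      μ.real {ω | ∀ l ≤ n, X (t l) ω = i l} * p (t (n + 1) - t n) (i n) (i (n + 1))

lemma IsMarkov.grid (h : IsMarkov μ p X) (s : ℝ≥0) (i : ℕ → ℕ) (n : ℕ) :
    μ.real {ω | ∀ l ≤ n + 1, X (l * s) ω = i l} =
      μ.real {ω | ∀ l ≤ n, X (l * s) ω = i l} * p s (i n) (i (n + 1)) := by
  have hmono : Monotone fun l : ℕ => (l : ℝ≥0) * s := fun a c hac => by
    have : (a : ℝ≥0) ≤ c := by exact_mod_cast hac
    exact mul_le_mul_left this s
  have h1 := h (fun l => l * s) hmono i n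
  have e : ((n + 1 : ℕ) : ℝ≥0) * s - n * s = s := by
    rw [Nat.cast_succ, add_mul, one_mul, add_tsub_cancel_left]
  rwa [e] at h1

lemma IsMarkov.two_point (h : IsMarkov μ p X) {s t : ℝ≥0} (hst : s ≤ t) (i j : ℕ) :
    μ.real {ω | X s ω = i ∧ X t ω = j} = μ.real {ω | X s ω = i} * p (t - s) i j := by
  have hmono : Monotone fun l : ℕ => if l = 0 then s else t := fun a c hac => by
    dsimp only
    split_ifs with h1 h2 h2
    exacts [le_rfl, hst, absurd (Nat.le_zero.1 (h2 ▸ hac)) h1, le_rfl]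
  have h1 := h _ hmono (fun l => if l = 0 then i else j) 0
  have e1 : {ω | ∀ l ≤ 0 + 1, X (if l = 0 then s else t) ω = if l = 0 then i else j} =
      {ω | X s ω = i ∧ X t ω = j} := by
    ext ω
    simp only [mem_ofPred_eq]
    refine ⟨fun h => ⟨by simpa using h 0 (by omega), by simpa using h 1 (by omega)⟩, ?_⟩
    rintro ⟨h1, h2⟩ l hl
    split_ifs
    exacts [h1, h2]
  have e2 : {ω | ∀ l ≤ 0, X (if l = 0 then s else t) ω = if l = 0 then i else j} =
      {ω | X s ω = i} := by
    ext ω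
    simp
  rw [e1, e2] at h1
  simpa using h1

/-- The number of crossings up to time `T`. -/
noncomputable def crossingCount (m : ℕ) (X : ℝ≥0 → Ω → ℕ) (T : ℝ≥0) (ω : Ω) : ℕ :=
  (crossingSet m (fun t => X t ω) 0 T).encard.toNat

omit [MeasurableSpace Ω] in
lemma eventually_gridCount_eq {m : ℕ} (hm : 1 < m) {ω : Ω} (hx : IsRegularPath fun t => X t ω)
    {T : ℝ≥0} (hT : 0 < T) : ∀ᶠ n : ℕ in atTop,
      gridCount m (fun l => X (l * (T / (n + 1 : ℕ))) ω) (n + 1) = crossingCount m X T ω := by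
  filter_upwards [hx.eventually_encard_crossingSet hm hT] with n hn
  rw [crossingCount, hn]
  rfl

lemma aemeasurable_crossingCount (hX : ∀ t, Measurable (X t))
    (hreg : ∀ᵐ ω ∂μ, IsRegularPath fun t => X t ω) {m : ℕ} (hm : 1 < m) {T : ℝ≥0} (hT : 0 < T) :
    AEMeasurable (crossingCount m X T) μ := by
  refine aemeasurable_of_tendsto_metrizable_ae' (fun n : ℕ => (measurable_gridCount m
    (A := fun l ω => X (l * (T / (n + 1 : ℕ))) ω) (fun l => hX _) (n + 1)).aemeasurable) ?_
  filter_upwards [hreg] with ω hx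
  refine tendsto_const_nhds.congr' ?_
  filter_upwards [eventually_gridCount_eq hm hx hT] with n hn
  exact hn.symm

variable [IsProbabilityMeasure μ]

lemma IsMarkov.law (h : IsMarkov μ p X) (hX0 : ∀ᵐ ω ∂μ, X 0 ω = 1) (T : ℝ≥0) (j : ℕ) :
    μ.real {ω | X T ω = j} = p T 1 j := by
  have h1 := h.two_point (zero_le (a := T)) 1 j
  have e1 : μ.real {ω | X 0 ω = 1 ∧ X T ω = j} = μ.real {ω | X T ω = j} := by
    refine measureReal_congr ?_
    filter_upwards [hX0] with ω hω
    exact propext ⟨fun h => h.2, fun h => ⟨hω, h⟩⟩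
  have e2 : μ.real {ω | X 0 ω = 1} = 1 := by
    rw [← probReal_univ (μ := μ)]
    refine measureReal_congr ?_
    filter_upwards [hX0] with ω hω
    exact propext ⟨fun _ => mem_univ ω, fun _ => hω⟩
  rwa [e1, e2, one_mul, tsub_zero] at h1

/-- Honesty and p_00 = 1 force p_0j = 0 for j ≠ 0; this excludes leaving 0 between any two rational
times, and right-continuity covers the others. -/
lemma IsMarkov.ae_absorbed (h : IsMarkov μ p X) (hp : IsWMBTransitionFunction w b p)
    (hreg : ∀ᵐ ω ∂μ, IsRegularPath fun t => X t ω) :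
    ∀ᵐ ω ∂μ, ∀ s t, s ≤ t → X s ω = 0 → X t ω = 0 := by
  have h1 : ∀ᵐ ω ∂μ, ∀ p q : ℚ, p ≤ q → X (p : ℝ).toNNReal ω = 0 → X (q : ℝ).toNNReal ω = 0 := by
    refine ae_all_iff.2 fun r => ae_all_iff.2 fun q => ?_
    by_cases hrq : r ≤ q
    swap
    · exact Eventually.of_forall fun ω h => absurd h hrq
    have hle : (r : ℝ).toNNReal ≤ (q : ℝ).toNNReal := Real.toNNReal_mono (by exact_mod_cast hrq)
    have hj : ∀ᵐ ω ∂μ, ∀ j, j ≠ 0 → ¬ (X (r : ℝ).toNNReal ω = 0 ∧ X (q : ℝ).toNNReal ω = j) := by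
      refine ae_all_iff.2 fun j => ?_
      by_cases hj0 : j = 0
      · exact Eventually.of_forall fun ω h => absurd hj0 h
      have hpz : p ((q : ℝ).toNNReal - (r : ℝ).toNNReal) 0 j = 0 := by
        have h2 := sum_le_hasSum {0, j}
          (fun k _ => hp.nonneg ((q : ℝ).toNNReal - (r : ℝ).toNNReal) 0 k) (hp.hasSum_one _ 0)
        rw [Finset.sum_pair (Ne.symm hj0), hp.zero_zero] at h2
        exact le_antisymm (by linarith) (hp.nonneg _ _ _)
      have h3 := h.two_point hle 0 j
      rw [hpz, mul_zero, measureReal_eq_zero_iff] at h3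
      have h4 := measure_eq_zero_iff_ae_notMem.1 h3
      filter_upwards [h4] with ω hω _
      exact hω
    filter_upwards [hj] with ω hω _ h0
    by_contra hne
    exact hω _ hne ⟨h0, rfl⟩
  filter_upwards [h1, hreg] with ω hω hx
  exact hx.absorbed hω

/-- The martingale identity for `v ^ (number of crossings) * u ^ (current state)`. -/
lemma IsMarkov.integral_crossingCount (h : IsMarkov μ p X) (hp : IsWMBTransitionFunction w b p)
    (hX : ∀ t, Measurable (X t)) (hreg : ∀ᵐ ω ∂μ, IsRegularPath fun t => X t ω)
    (hX0 : ∀ᵐ ω ∂μ, X 0 ω = 1) (hb : IsBranchingRate b) {m : ℕ} (hm : 1 < m) {v u : ℝ}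
    (hv : v ∈ Icc (0 : ℝ) 1) (hu : u ∈ Icc (0 : ℝ) 1)
    (huv : HasSum (fun k => (if k = m then v else 1) * (b k * u ^ k)) 0) {T : ℝ≥0} (hT : 0 < T) :
    ∫ ω, v ^ crossingCount m X T ω * u ^ X T ω ∂μ = u := by
  set A : ℕ → ℕ → Ω → ℕ := fun n l ω => X (l * (T / (n + 1 : ℕ))) ω with hA
  have hAm : ∀ n l, Measurable (A n l) := fun n l => hX _
  have hAT : ∀ n, A n (n + 1) = X T := fun n => by
    simp only [hA]
    rw [mul_div_cancel₀ T (by positivity)]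
  have hA0 : ∀ n, A n 0 = X 0 := fun n => by simp [hA]
  have hlim : Tendsto (fun n => ∫ ω, gridValue m v u (fun l => A n l ω) (n + 1) ∂μ) atTop
      (𝓝 (∫ ω, v ^ crossingCount m X T ω * u ^ X T ω ∂μ)) := by
    refine tendsto_integral_of_dominated_convergence (fun _ => 1)
      (fun n => (measurable_gridValue m v u (hAm n) (n + 1)).aestronglyMeasurable)
      (integrable_const _) (fun n => Eventually.of_forall fun ω => ?_) ?_
    · have h1 := gridValue_mem (m := m) hv hu (fun l => A n l ω) (n + 1)
      rw [Real.norm_of_nonneg h1.1]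
      exact h1.2
    · filter_upwards [hreg] with ω hx
      refine tendsto_const_nhds.congr' ?_
      filter_upwards [eventually_gridCount_eq hm hx hT] with n hn
      rw [gridValue, hAT, ← hn]
  have hstart : ∀ n, ∫ ω, gridValue m v u (fun l => A n l ω) 0 ∂μ = u := fun n => by
    have e : (fun ω => gridValue m v u (fun l => A n l ω) 0) =ᵐ[μ] fun _ => u := by
      filter_upwards [hX0] with ω hω
      rw [gridValue, hA0, hω, gridCount, Finset.sum_range_zero, pow_zero, one_mul, pow_one]
    rw [integral_congr_ae e]
    simp
  -- The exceptional event covers all grids at once, so it does not depend on n. It shrinks to a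
  -- null set as N grows because regular paths are bounded on [0, T].
  set E : ℕ → Set Ω := fun N => ⋃ (n : ℕ) (l : ℕ) (_ : l ≤ n + 1), {ω | N < A n l ω} with hE
  have hEm : ∀ N, MeasurableSet (E N) := fun N =>
    MeasurableSet.iUnion fun n => MeasurableSet.iUnion fun l => MeasurableSet.iUnion fun _ =>
      (hAm n l) (measurableSet_Ioi (a := N))
  have hEmem : ∀ N ω, ω ∈ E N ↔ ∃ n l, l ≤ n + 1 ∧ N < A n l ω := fun N ω => by
    simp [hE]
  have hEanti : Antitone E := fun N M hNM ω hω => by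
    rw [hEmem] at hω ⊢
    obtain ⟨n, l, hl, h1⟩ := hω
    exact ⟨n, l, hl, hNM.trans_lt h1⟩
  have hEnull : μ (⋂ N, E N) = 0 := by
    refine measure_eq_zero_iff_ae_notMem.2 ?_
    filter_upwards [hreg] with ω hx hmem
    obtain ⟨N, hN⟩ := hx.exists_bound T
    obtain ⟨n, l, hl, h1⟩ := (hEmem N ω).1 (mem_iInter.1 hmem N)
    refine h1.not_ge (hN _ ?_)
    calc (l : ℝ≥0) * (T / (n + 1 : ℕ)) ≤ (n + 1 : ℕ) * (T / (n + 1 : ℕ)) := by gcongr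
      _ = T := mul_div_cancel₀ T (by positivity)
  have hElim : Tendsto (fun N => μ.real (E N)) atTop (𝓝 0) := by
    have h1 := tendsto_measure_iInter_atTop (μ := μ) (fun N => (hEm N).nullMeasurableSet) hEanti
      ⟨0, measure_ne_top _ _⟩
    rw [hEnull] at h1
    exact (ENNReal.tendsto_toReal ENNReal.zero_ne_top).comp h1
  have hbound : ∀ N, |(∫ ω, v ^ crossingCount m X T ω * u ^ X T ω ∂μ) - u| ≤ μ.real (E N) := by
    intro N
    -- For fixed N only finitely many states matter, so the accumulated defect vanishes as n → ∞; N
    -- → ∞ is taken afterwards.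
    set g : ℕ → ℕ → ℝ := fun n i =>
      |(∑' j, p (T / (n + 1 : ℕ)) i j * markedPow m v u i j) - u ^ i| with hg
    have hη : Tendsto (fun n : ℕ => ((n + 1 : ℕ) : ℝ) * (∑ i ∈ Finset.range (N + 1), g n i))
        atTop (𝓝 0) := by
      simp only [Finset.mul_sum]
      rw [show (0 : ℝ) = ∑ i ∈ Finset.range (N + 1), 0 by simp]
      exact tendsto_finsetSum _ fun i _ => hp.tendsto_generator hb hm hv hu huv i hT
    have hle : ∀ n : ℕ, |(∫ ω, gridValue m v u (fun l => A n l ω) (n + 1) ∂μ) - u| ≤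
        ((n + 1 : ℕ) : ℝ) * (∑ i ∈ Finset.range (N + 1), g n i) + μ.real (E N) := by
      intro n
      have h1 := abs_integral_gridValue_sub_le (μ := μ) (hAm n)
        (P := p (T / (n + 1 : ℕ))) (hp.nonneg _) (hp.hasSum_one _)
        (h.grid (T / (n + 1 : ℕ))) hv hu N (m := m)
        (η := ∑ i ∈ Finset.range (N + 1), g n i) (Finset.sum_nonneg fun i _ => abs_nonneg _)
        (fun i hi => Finset.single_le_sum (f := g n) (fun i _ => abs_nonneg _)
          (Finset.mem_range.2 (by omega))) (n + 1) (hEm N) (fun ω hω l hl => by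
            by_contra! hlt
            exact hω ((hEmem N ω).2 ⟨n, l, hl, hlt⟩))
      rwa [hstart] at h1
    have h2 := hη.add_const (μ.real (E N))
    rw [zero_add] at h2
    exact le_of_tendsto_of_tendsto' (hlim.sub_const u).abs h2 hle
  have h3 := ge_of_tendsto' hElim hbound
  exact sub_eq_zero.1 (abs_eq_zero.1 (le_antisymm h3 (abs_nonneg _)))

lemma integral_comp_eq_tsum {Z : Ω → ℕ} (hZ : AEMeasurable Z μ) {φ : ℕ → ℝ}
    (hφ : ∀ j, |φ j| ≤ 1) : HasSum (fun j => (μ.map Z).real {j} * φ j) (∫ ω, φ (Z ω) ∂μ) := by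
  have hprob : IsProbabilityMeasure (μ.map Z) := Measure.isProbabilityMeasure_map hZ
  have hm : Measurable φ := measurable_of_countable _
  have hint : Integrable φ (μ.map Z) :=
    Integrable.of_bound hm.aestronglyMeasurable 1 (Eventually.of_forall hφ)
  have hs := hasSum_measureReal_preimage (μ.map Z) measurable_id
  have hs2 : Summable fun j => (μ.map Z).real {j} * φ j :=
    Summable.of_norm_bounded hs.summable.norm fun j => by
      rw [norm_mul]; exact mul_le_of_le_one_right (norm_nonneg _) (hφ j)
  rw [← integral_map hZ hm.aestronglyMeasurable, integral_countable hint]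
  exact hs2.hasSum

end MarkovChain

/-! ### Passage to the extinction time -/

section Extinction

variable {Ω : Type*} [MeasurableSpace Ω] {μ : Measure Ω} [IsProbabilityMeasure μ] {w b : ℕ → ℝ}
  {p : ℝ≥0 → ℕ → ℕ → ℝ} {X : ℝ≥0 → Ω → ℕ} {m : ℕ}

/-- Each term tends to 0 by transience, and u^j is a summable majorant since u < 1. -/
lemma IsMarkov.tendsto_integral_ne_zero (h : IsMarkov μ p X) (hp : IsWMBTransitionFunction w b p)
    (hX : ∀ t, Measurable (X t)) (hX0 : ∀ᵐ ω ∂μ, X 0 ω = 1) (hw : ∀ i, 1 ≤ i → 0 < w i)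
    (hb0 : 0 < b 0) {u : ℝ} (hu0 : 0 ≤ u) (hu1 : u < 1) :
    Tendsto (fun n : ℕ => ∫ ω, (if X (n + 1 : ℕ) ω = 0 then 0 else u ^ X (n + 1 : ℕ) ω) ∂μ) atTop
      (𝓝 0) := by
  have hφ : ∀ j : ℕ, |if j = 0 then 0 else u ^ j| ≤ 1 := fun j => by
    split_ifs
    · simp
    · rw [abs_of_nonneg (pow_nonneg hu0 j)]
      exact pow_le_one₀ hu0 hu1.le
  have e : ∀ n : ℕ, ∫ ω, (if X (n + 1 : ℕ) ω = 0 then 0 else u ^ X (n + 1 : ℕ) ω) ∂μ =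
      ∑' j, p (n + 1 : ℕ) 1 j * if j = 0 then 0 else u ^ j := fun n => by
    rw [← (integral_comp_eq_tsum (hX (n + 1 : ℕ)).aemeasurable hφ).tsum_eq]
    refine tsum_congr fun j => ?_
    rw [map_measureReal_apply (hX _) (measurableSet_singleton j), ← h.law hX0]
    rfl
  simp only [e]
  have hT : Tendsto (fun n : ℕ => ((n + 1 : ℕ) : ℝ≥0)) atTop atTop :=
    tendsto_natCast_atTop_atTop.comp (tendsto_add_atTop_nat 1)
  have hlim := tendsto_tsum_of_dominated_convergence (𝓕 := atTop) (β := ℕ)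
    (f := fun (n : ℕ) j => p (n + 1 : ℕ) 1 j * if j = 0 then 0 else u ^ j) (g := fun _ => 0)
    (bound := fun j => u ^ j) (summable_geometric_of_lt_one hu0 hu1) (fun j => ?_)
    (Eventually.of_forall fun n j => ?_)
  · rwa [tsum_zero] at hlim
  · rcases Nat.eq_zero_or_pos j with rfl | hj
    · simp
    · simpa using ((hp.tendsto_zero hw hb0 1 hj).comp hT).mul_const
        (if j = 0 then 0 else u ^ j)
  · rw [norm_mul, Real.norm_of_nonneg (hp.nonneg _ _ _)]
    refine (mul_le_of_le_one_left (norm_nonneg _) (hp.le_one _ _ _)).trans ?_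
    split_ifs
    · rw [norm_zero]; exact pow_nonneg hu0 j
    · rw [Real.norm_of_nonneg (pow_nonneg hu0 j)]

/-- The number of crossings until extinction plus one, or zero without extinction. -/
noncomputable def extinctionCount (m : ℕ) (X : ℝ≥0 → Ω → ℕ) (ω : Ω) : ℕ :=
  open Classical in
  if extinctionTime (fun t => X t ω) < ∞ then
    (crossingNumber m (fun t => X t ω) (extinctionTime fun t => X t ω)).toNat + 1 else 0

omit [MeasurableSpace Ω] in
lemma eventually_extinctionCount_eq {ω : Ω} (h0 : ∀ s t, s ≤ t → X s ω = 0 → X t ω = 0)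
    (hm : 1 < m) : ∀ᶠ n : ℕ in atTop,
      (if X (n + 1 : ℕ) ω = 0 then crossingCount m X (n + 1 : ℕ) ω + 1 else 0) =
        extinctionCount m X ω := by
  by_cases h : extinctionTime (fun t => X t ω) < ∞
  · obtain ⟨t, ht⟩ := extinctionTime_lt_top.1 h
    obtain ⟨N, hN⟩ := exists_nat_ge t
    filter_upwards [eventually_ge_atTop N] with n hn
    have hXn : X (n + 1 : ℕ) ω = 0 := by
      refine h0 t _ (hN.trans ?_) ht
      exact_mod_cast (by omega : N ≤ n + 1)
    rw [if_pos hXn, extinctionCount, if_pos h, crossingCount,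
      crossingNumber_extinctionTime (x := fun t => X t ω) h0 hm hXn]
  · refine Eventually.of_forall fun n => ?_
    rw [extinctionCount, if_neg h, if_neg fun hn => h (extinctionTime_lt_top.2 ⟨_, hn⟩)]

lemma IsMarkov.aemeasurable_extinctionCount (h : IsMarkov μ p X)
    (hp : IsWMBTransitionFunction w b p) (hX : ∀ t, Measurable (X t))
    (hreg : ∀ᵐ ω ∂μ, IsRegularPath fun t => X t ω) (hm : 1 < m) :
    AEMeasurable (extinctionCount m X) μ := by
  refine aemeasurable_of_tendsto_metrizable_ae' (f := fun (n : ℕ) ω =>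
    if X (n + 1 : ℕ) ω = 0 then crossingCount m X (n + 1 : ℕ) ω + 1 else 0) (fun n => ?_) ?_
  · have h1 := (aemeasurable_crossingCount (μ := μ) hX hreg hm
      (show (0 : ℝ≥0) < (n + 1 : ℕ) by positivity)).prodMk (hX (n + 1 : ℕ)).aemeasurable
    exact (measurable_of_countable fun z : ℕ × ℕ => if z.2 = 0 then z.1 + 1 else 0).comp_aemeasurable
      h1
  · filter_upwards [h.ae_absorbed hp hreg] with ω h0
    refine tendsto_const_nhds.congr' ?_
    filter_upwards [eventually_extinctionCount_eq h0 hm] with n hn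
    exact hn.symm

/-- The generating function of the number of crossings until extinction, as a function of
`extinctionCount`. -/
noncomputable def countPow (v : ℝ) : ℕ → ℝ
  | 0 => 0
  | k + 1 => v ^ k

lemma countPow_mem {v : ℝ} (hv : v ∈ Icc (0 : ℝ) 1) (k : ℕ) : countPow v k ∈ Icc (0 : ℝ) 1 := by
  cases k with
  | zero => exact ⟨le_rfl, zero_le_one⟩
  | succ k => exact ⟨pow_nonneg hv.1 k, pow_le_one₀ hv.1 hv.2⟩

lemma abs_countPow_le {v : ℝ} (hv : v ∈ Icc (0 : ℝ) 1) (k : ℕ) : |countPow v k| ≤ 1 := by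
  rw [abs_of_nonneg (countPow_mem hv k).1]
  exact (countPow_mem hv k).2

/-- At integer times the constant mean u splits into the part where the chain is extinct, which
converges to the wanted expectation, and a rest between 0 and E[u^X; X ≠ 0], which vanishes. -/
lemma IsMarkov.integral_countPow (h : IsMarkov μ p X) (hp : IsWMBTransitionFunction w b p)
    (hX : ∀ t, Measurable (X t)) (hreg : ∀ᵐ ω ∂μ, IsRegularPath fun t => X t ω)
    (hX0 : ∀ᵐ ω ∂μ, X 0 ω = 1) (hb : IsBranchingRate b) (hb0 : 0 < b 0)
    (hw : ∀ i, 1 ≤ i → 0 < w i) (hm : 1 < m) {v u : ℝ}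
    (hv : v ∈ Icc (0 : ℝ) 1) (hu0 : 0 ≤ u) (hu1 : u < 1)
    (huv : HasSum (fun k => (if k = m then v else 1) * (b k * u ^ k)) 0) :
    ∫ ω, countPow v (extinctionCount m X ω) ∂μ = u := by
  set C : ℕ → Ω → ℕ := fun n => crossingCount m X (n + 1 : ℕ) with hC
  set Z : ℕ → Ω → ℕ := fun n ω => if X (n + 1 : ℕ) ω = 0 then C n ω + 1 else 0 with hZ
  have hpos : ∀ n : ℕ, (0 : ℝ≥0) < (n + 1 : ℕ) := fun n => by positivity
  have hCX : ∀ n, AEMeasurable (fun ω => (C n ω, X (n + 1 : ℕ) ω)) μ := fun n =>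
    (aemeasurable_crossingCount hX hreg hm (hpos n)).prodMk (hX _).aemeasurable
  have hZm : ∀ n, AEMeasurable (fun ω => countPow v (Z n ω)) μ := fun n =>
    (measurable_of_countable fun z : ℕ × ℕ =>
      countPow v (if z.2 = 0 then z.1 + 1 else 0)).comp_aemeasurable (hCX n)
  have hlim : Tendsto (fun n => ∫ ω, countPow v (Z n ω) ∂μ) atTop
      (𝓝 (∫ ω, countPow v (extinctionCount m X ω) ∂μ)) := by
    refine tendsto_integral_of_dominated_convergence (fun _ => 1)
      (fun n => (hZm n).aestronglyMeasurable) (integrable_const _)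
      (fun n => Eventually.of_forall fun ω => abs_countPow_le hv _) ?_
    filter_upwards [h.ae_absorbed hp hreg] with ω h0
    refine tendsto_const_nhds.congr' ?_
    filter_upwards [eventually_extinctionCount_eq (X := X) h0 hm] with n hn
    rw [← hn]
  have hrest := h.tendsto_integral_ne_zero hp hX hX0 hw hb0 hu0 hu1
  have huI : u ∈ Icc (0 : ℝ) 1 := ⟨hu0, hu1.le⟩
  have hVi : ∀ n, Integrable (fun ω => v ^ C n ω * u ^ X (n + 1 : ℕ) ω) μ := fun n =>
    Integrable.of_bound ((measurable_of_countable fun z : ℕ × ℕ =>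
      v ^ z.1 * u ^ z.2).comp_aemeasurable (hCX n)).aestronglyMeasurable 1
      (Eventually.of_forall fun ω => by
        rw [norm_mul, norm_pow, norm_pow, Real.norm_of_nonneg hv.1, Real.norm_of_nonneg hu0]
        exact mul_le_one₀ (pow_le_one₀ hv.1 hv.2) (pow_nonneg hu0 _) (pow_le_one₀ hu0 hu1.le))
  have hZi : ∀ n, Integrable (fun ω => countPow v (Z n ω)) μ := fun n =>
    Integrable.of_bound (hZm n).aestronglyMeasurable 1
      (Eventually.of_forall fun ω => abs_countPow_le hv _)
  have hRi : ∀ n : ℕ, Integrable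
      (fun ω => if X (n + 1 : ℕ) ω = 0 then 0 else u ^ X (n + 1 : ℕ) ω) μ := fun n => by
    refine Integrable.of_bound ((measurable_of_countable fun z : ℕ =>
      if z = 0 then (0 : ℝ) else u ^ z).comp (hX (n + 1 : ℕ))).aestronglyMeasurable 1
      (Eventually.of_forall fun ω => ?_)
    change ‖if X (n + 1 : ℕ) ω = 0 then (0 : ℝ) else u ^ X (n + 1 : ℕ) ω‖ ≤ 1
    split_ifs
    · simp
    · rw [norm_pow, Real.norm_of_nonneg hu0]
      exact pow_le_one₀ hu0 hu1.le
  have hval : ∀ n, ∫ ω, v ^ C n ω * u ^ X (n + 1 : ℕ) ω ∂μ = u := fun n =>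
    h.integral_crossingCount hp hX hreg hX0 hb hm hv huI huv (hpos n)
  have hle : ∀ n, ∫ ω, countPow v (Z n ω) ∂μ ≤ u := fun n => by
    rw [← hval n]
    refine integral_mono (hZi n) (hVi n) fun ω => ?_
    simp only [hZ]
    split_ifs with hω
    · rw [hω, pow_zero, mul_one]; exact le_rfl
    · exact mul_nonneg (pow_nonneg hv.1 _) (pow_nonneg hu0 _)
  have hge : ∀ n : ℕ, u - ∫ ω, (if X (n + 1 : ℕ) ω = 0 then 0 else u ^ X (n + 1 : ℕ) ω) ∂μ ≤
      ∫ ω, countPow v (Z n ω) ∂μ := fun n => by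
    have e : u - ∫ ω, (if X (n + 1 : ℕ) ω = 0 then 0 else u ^ X (n + 1 : ℕ) ω) ∂μ =
        ∫ ω, (v ^ C n ω * u ^ X (n + 1 : ℕ) ω -
          if X (n + 1 : ℕ) ω = 0 then 0 else u ^ X (n + 1 : ℕ) ω) ∂μ := by
      rw [integral_sub (hVi n) (hRi n), hval n]
    rw [e]
    refine integral_mono ((hVi n).sub (hRi n)) (hZi n) fun ω => ?_
    simp only [hZ]
    split_ifs with hω
    · rw [hω, pow_zero, mul_one, sub_zero]; exact le_rfl
    · rw [countPow, sub_nonpos]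
      exact mul_le_of_le_one_left (pow_nonneg hu0 _) (pow_le_one₀ hv.1 hv.2)
  refine le_antisymm (le_of_tendsto' hlim hle) ?_
  have h2 := hrest.const_sub u
  rw [sub_zero] at h2
  exact le_of_tendsto_of_tendsto' h2 hlim hge

/-- The law of the number of crossings until extinction, given that its generating function
solves `B_m(u) + b_m v u ^ m = 0`. -/
theorem IsMarkov.law_extinctionCount (h : IsMarkov μ p X) (hp : IsWMBTransitionFunction w b p)
    (hX : ∀ t, Measurable (X t)) (hreg : ∀ᵐ ω ∂μ, IsRegularPath fun t => X t ω)
    (hX0 : ∀ᵐ ω ∂μ, X 0 ω = 1) (hb : IsBranchingRate b) (hb0 : 0 < b 0)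
    (hw : ∀ i, 1 ≤ i → 0 < w i) (hm : 1 < m) {r : ℕ → ℝ} (hr : Summable r)
    (hsol : ∀ v, 0 ≤ v → v < 1 → ∃ u, 0 < u ∧ u < 1 ∧ HasSum (fun k => r k * v ^ k) u ∧
      HasSum (fun i => (if i = m then v else 1) * (b i * u ^ i)) 0) :
    (∀ k, μ.real (extinctionCount m X ⁻¹' {k + 1}) = r k) ∧
      ∀ v ∈ Icc (0 : ℝ) 1,
        HasSum (fun k => r k * v ^ k) (∫ ω, countPow v (extinctionCount m X ω) ∂μ) := by
  have hZ := h.aemeasurable_extinctionCount hp hX hreg hm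
  have hprob : IsProbabilityMeasure (μ.map (extinctionCount m X)) :=
    Measure.isProbabilityMeasure_map hZ
  set q : ℕ → ℝ := fun k => (μ.map (extinctionCount m X)).real {k + 1} with hq
  have hqs : Summable q := by
    have h1 : Summable fun k : ℕ => (μ.map (extinctionCount m X)).real {k} :=
      (hasSum_measureReal_preimage (μ.map (extinctionCount m X)) measurable_id).summable
    exact (summable_nat_add_iff (f := fun k : ℕ => (μ.map (extinctionCount m X)).real {k}) 1).2 h1
  have hqv : ∀ v ∈ Icc (0 : ℝ) 1,
      HasSum (fun k => q k * v ^ k) (∫ ω, countPow v (extinctionCount m X ω) ∂μ) := by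
    intro v hv
    have h1 := integral_comp_eq_tsum hZ (abs_countPow_le hv)
    rw [← hasSum_nat_add_iff' 1] at h1
    simpa [countPow] using h1
  -- The expectation equals whichever solution u < 1 is supplied, so uniqueness of the root need not
  -- be known. The case v = 1 follows from the equality of coefficients.
  have hqr : q = r := by
    refine eq_of_tsum_mul_pow_eq hqs hr fun v hv0 hv1 => ?_
    obtain ⟨u, hu0, hu1, hru, huv⟩ := hsol v hv0.le hv1
    rw [(hqv v ⟨hv0.le, hv1.le⟩).tsum_eq, hru.tsum_eq]
    exact h.integral_countPow hp hX hreg hX0 hb hb0 hw hm ⟨hv0.le, hv1.le⟩ hu0.le hu1 huv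
  refine ⟨fun k => ?_, hqr ▸ hqv⟩
  rw [← hqr]
  simp only [hq, Measure.real]
  rw [Measure.map_apply_of_aemeasurable hZ (measurableSet_singleton _)]

end Extinction

end WMBP

/-! ### Conditioning on extinction -/

theorem corollary3p2 (b : ℕ → ℝ) (hb : WMBP.IsBranchingRate b) (hb0 : 0 < b 0)
    (m : ℕ) (hm : 1 < m) (hbm : 0 < b m) :
    ∃ (ρ : ℝ) (r : ℕ → ℝ),
      IsLeast {u : ℝ | 0 ≤ u ∧ WMBP.B b u = 0} ρ ∧ 0 < ρ ∧
      IsLeast {u : ℝ | 0 ≤ u ∧ WMBP.Bm b m u = 0} (r 0) ∧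
      deriv (WMBP.Bm b m) (r 0) < 0 ∧
      r 1 = -(b m * r 0 ^ m) / deriv (WMBP.Bm b m) (r 0) ∧
      (∀ k, 1 ≤ k → Summable (WMBP.recTerm b m r k) ∧
        r (k + 1) = -((∑' i, WMBP.recTerm b m r k i) + b m * WMBP.convPow r m k) /
          deriv (WMBP.Bm b m) (r 0)) ∧
      ∀ {Ω : Type*} [MeasurableSpace Ω] (μ : Measure Ω) [IsProbabilityMeasure μ]
        (w : ℕ → ℝ) (_ : ∀ i, 1 ≤ i → 0 < w i) (X : ℝ≥0 → Ω → ℕ)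
        (_ : WMBP.IsWMBProcess μ w b X) (_ : ∀ᵐ ω ∂μ, X 0 ω = 1)
        (τ : Ω → ℝ≥0∞) (_ : τ = fun ω => WMBP.extinctionTime (fun t => X t ω))
        (Y : Ω → ℕ∞) (_ : Y = fun ω => WMBP.crossingNumber m (fun t => X t ω) (τ ω)),
        0 < μ {ω | τ ω < ∞} ∧
        (∀ v ∈ Icc (0 : ℝ) 1,
          HasSum (fun k => ρ⁻¹ * (r k * v ^ k)) (∫ ω, v ^ (Y ω).toNat ∂μ[|{ω | τ ω < ∞}])) ∧
        ∀ k : ℕ, (μ[|{ω | τ ω < ∞}]).real {ω | Y ω = k} = ρ⁻¹ * r k := by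
  obtain ⟨ρ, r, hρ, hρ0, hr0, hD, hr1, hrec, hsum, hsol⟩ := WMBP.exists_solution hb hb0 hm hbm
  refine ⟨ρ, r, hρ, hρ0, hr0, hD, hr1, hrec, ?_⟩
  intro Ω _ μ _ w hw X hX hX0 τ hτ Y hY
  obtain ⟨p, hp, hmarkov⟩ := hX.markov
  have hM : WMBP.IsMarkov μ p X := hmarkov
  obtain ⟨hlaw, hgen⟩ := hM.law_extinctionCount hp hX.measurable hX.regular hX0 hb hb0 hw hm
    hsum.summable hsol
  have habs := hM.ae_absorbed hp hX.regular
  set S : Set Ω := {ω | τ ω < ∞} with hS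
  -- By absorption, extinction is almost surely seen at an integer time; this gives a measurable
  -- version of the event, as the formula for conditional probability requires.
  set S' : Set Ω := ⋃ n : ℕ, {ω | X (n + 1 : ℕ) ω = 0} with hS'
  have hS'm : MeasurableSet S' := MeasurableSet.iUnion fun n =>
    hX.measurable _ (measurableSet_singleton 0)
  have hmemS : ∀ ω, ω ∈ S ↔ ∃ t, X t ω = 0 := fun ω => by
    rw [hS, hτ]
    exact WMBP.extinctionTime_lt_top
  have hSS' : S =ᵐ[μ] S' := by
    filter_upwards [habs] with ω h0
    refine propext ?_
    change ω ∈ S ↔ ω ∈ S'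
    rw [hmemS, hS', mem_iUnion]
    constructor
    · rintro ⟨t, ht⟩
      obtain ⟨N, hN⟩ := exists_nat_ge t
      refine ⟨N, h0 t _ (hN.trans ?_) ht⟩
      exact_mod_cast Nat.le_succ N
    · rintro ⟨n, hn⟩
      exact ⟨_, hn⟩
  have hcount : ∀ ω ∈ S, WMBP.extinctionCount m X ω = (Y ω).toNat + 1 := fun ω hω => by
    have h1 : WMBP.extinctionTime (fun t => X t ω) < ∞ := by
      have h2 : τ ω < ∞ := hω
      rwa [hτ] at h2
    rw [WMBP.extinctionCount, if_pos h1, hY, hτ]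
  have hcount0 : ∀ ω, ω ∉ S → WMBP.extinctionCount m X ω = 0 := fun ω hω => by
    have h1 : ¬ WMBP.extinctionTime (fun t => X t ω) < ∞ := fun h2 => hω (by
      change τ ω < ∞
      rwa [hτ])
    rw [WMBP.extinctionCount, if_neg h1]
  -- `toNat` sends ⊤ to 0, so finiteness is needed to recover Y from it.
  have hfin : ∀ᵐ ω ∂μ, ω ∈ S → Y ω ≠ ⊤ := by
    filter_upwards [habs, hX.regular] with ω h0 hx hω
    obtain ⟨t, ht⟩ := (hmemS ω).1 hω
    have h1 : X (t + 1) ω = 0 := h0 t _ le_self_add ht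
    rw [hY, hτ]
    change WMBP.crossingNumber m (fun t => X t ω) (WMBP.extinctionTime fun t => X t ω) ≠ ⊤
    rw [WMBP.crossingNumber_extinctionTime (x := fun t => X t ω) h0 hm h1]
    exact encard_ne_top_iff.2 (hx.finite_crossingSet hm (by positivity))
  have hind : ∀ v : ℝ, (fun ω => WMBP.countPow v (WMBP.extinctionCount m X ω)) =ᵐ[μ]
      S'.indicator fun ω => v ^ (Y ω).toNat := fun v => by
    filter_upwards [hSS'] with ω hω
    have hiff : ω ∈ S ↔ ω ∈ S' := Iff.of_eq hω
    by_cases h : ω ∈ S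
    · rw [indicator_of_mem (hiff.1 h), hcount ω h, WMBP.countPow]
    · rw [indicator_of_notMem fun h' => h (hiff.2 h'), hcount0 ω h, WMBP.countPow]
  -- At v = 1 the integrand is the indicator of extinction, so P(τ < ∞) = ∑ r_k = ρ.
  have hμS : μ.real S = ρ := by
    have h1 := hgen 1 ⟨zero_le_one, le_rfl⟩
    simp only [one_pow, mul_one] at h1
    rw [integral_congr_ae (hind 1), integral_indicator hS'm] at h1
    simp only [one_pow, setIntegral_const, smul_eq_mul, mul_one] at h1
    rw [measureReal_congr hSS', h1.unique hsum]
  have hcond : μ[|S] = μ[|S'] := by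
    rw [ProbabilityTheory.cond, ProbabilityTheory.cond, measure_congr hSS',
      Measure.restrict_congr_set hSS']
  have hμS' : μ.real S' = ρ := by rw [← hμS, measureReal_congr hSS']
  refine ⟨?_, fun v hv => ?_, fun k => ?_⟩
  · rw [pos_iff_ne_zero]
    intro h0
    rw [Measure.real, h0] at hμS
    exact hρ0.ne hμS
  · have h1 := (hgen v hv).mul_left ρ⁻¹
    rw [integral_congr_ae (hind v), integral_indicator hS'm] at h1
    rw [hcond, ProbabilityTheory.cond, integral_smul_measure, ENNReal.toReal_inv, smul_eq_mul]
    rwa [← Measure.real, hμS']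
  · rw [hcond, Measure.real, cond_apply hS'm, ENNReal.toReal_mul, ENNReal.toReal_inv,
      ← Measure.real, ← Measure.real, hμS', ← hlaw k]
    congr 1
    refine measureReal_congr ?_
    filter_upwards [hSS', hfin] with ω hω hωf
    have hiff : ω ∈ S ↔ ω ∈ S' := Iff.of_eq hω
    refine propext ?_
    change (ω ∈ S' ∧ Y ω = k) ↔ WMBP.extinctionCount m X ω = k + 1
    rw [← hiff]
    by_cases h : ω ∈ S
    · rw [hcount ω h, Nat.add_right_cancel_iff]
      refine ⟨fun h' => by rw [h'.2]; rfl, fun h' => ⟨h, ?_⟩⟩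
      rw [← h', ENat.natCast_toNat (hωf h)]
    · rw [hcount0 ω h]
      exact ⟨fun h' => absurd h'.1 h, fun h' => by omega⟩
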